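/- Write $\langle u,v\rangle$ for the extension to $\mathcal S'\times\mathcal S$ of the inner product $\int u\,\overline{v}$ of $L^2$ (conjugate-linear in $v$). Fix $d$, a matrix $A=\begin{pmatrix}A_{11}&A_{12}\\A_{21}&A_{22}\end{pmatrix}\in GL(2d,\mathbb R)$ with $d\times d$ blocks, and a non-zero window $\Phi\in\mathcal S(\mathbb R^{2d})$. For $f,g\in\mathcal S(\mathbb R^d)$ put $$\mathcal B_A(f,g)(x,\omega)=\int_{\mathbb R^d}e^{-2\pi i\,\omega\cdot y}\,f(A_{11}x+A_{12}y)\,\overline{g(A_{21}x+A_{22}y)}\,dy ,\qquad x,\omega\in\mathbb R^d .$$ Let $M^1(\mathbb R^{2d})$ be the space of tempered distributions $\sigma$ on $\mathbb R^{2d}$ with $$\|\sigma\|_{M^1}=\int_{\mathbb R^{2d}}\int_{\mathbb R^{2d}}|V_\Phi\sigma(z,\zeta)|\,dz\,d\zeta<\infty,\qquad V_\Phi\sigma(z,\zeta)=\langle\sigma,\,e^{2\pi i\zeta\cdot(\,\cdot\,)}\,\Phi(\,\cdot\,-z)\rangle .$$ **Theorem.** There is a constant $C>0$, depending only on $d$,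 $A$ and $\Phi$, such that for every $\sigma\in M^1(\mathbb R^{2d})$ the following holds. There is exactly one bounded linear operator $\sigma^A$ on $L^2(\mathbb R^d)$ with $$\langle\sigma^A f,g\rangle=\langle\sigma,\mathcal B_A(g,f)\rangle\qquad\text{for all } f,g\in\mathcal S(\mathbb R^d).$$ The operator $\sigma^A$ is trace class, and its trace norm $\|\sigma^A\|_{\mathfrak S^1}=\operatorname{Tr}\big[\big((\sigma^A)^*\sigma^A\big)^{1/2}\big]$ satisfies $$\|\sigma^A\|_{\mathfrak S^1}\le C\,|\det A|^{1/2}\,\|\sigma\|_{M^1},\qquad\text{that is,}\qquad \|\sigma^A\|_{\mathfrak S^1}\lesssim_A|\det A|^{1/2}\,\|\sigma\|_{M^1}.$$ -/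

import Mathlib

open MeasureTheory SchwartzMap FourierTransform
open scoped ENNReal SchwartzMap ComplexConjugate RealInnerProductSpace

set_option linter.unusedSectionVars false
set_option linter.flexible false

section PartialFourier

variable {V : Type} [NormedAddCommGroup V] [InnerProductSpace ℝ V] [FiniteDimensional ℝ V]
  [MeasurableSpace V] [BorelSpace V]

theorem hasTemperateGrowth_mk (x : V) :
    (fun y : V => ((x, y) : V × V)).HasTemperateGrowth := by
  have h : (fun y : V => ((x, y) : V × V)) =
      (fun y => ((x, 0) : V × V) + ContinuousLinearMap.inr ℝ V V y) := by
    ext y <;> simp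
  rw [h]
  exact (Function.HasTemperateGrowth.const _).add
    (ContinuousLinearMap.hasTemperateGrowth _)

theorem antilipschitzWith_mk (x : V) :
    AntilipschitzWith 1 (fun y : V => ((x, y) : V × V)) :=
  AntilipschitzWith.of_le_mul_dist fun a b => by simp [Prod.dist_eq]

variable {F : Type} [NormedAddCommGroup F] [NormedSpace ℂ F] [CompleteSpace F]

/-- The section `y ↦ G (x, y)` of a Schwartz function. -/
noncomputable def schwartzSection (G : 𝓢(V × V, F)) (x : V) : 𝓢(V, F) :=
  compCLMOfAntilipschitz ℂ (hasTemperateGrowth_mk x) (antilipschitzWith_mk x) G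

theorem schwartzSection_apply (G : 𝓢(V × V, F)) (x y : V) :
    schwartzSection G x y = G (x, y) := rfl

/-- The partial Fourier transform in the second variable,
`(x, ω) ↦ ∫ e^{-2πi y·ω} G (x, y) dy`. -/
noncomputable def partialFourier (G : 𝓢(V × V, F)) (z : V × V) : F :=
  ∫ y : V, Real.fourierChar (-⟪y, z.2⟫) • G (z.1, y)

theorem partialFourier_eq (G : 𝓢(V × V, F)) (z : V × V) :
    partialFourier G z = (𝓕 (schwartzSection G z.1)) z.2 := by
  rw [fourier_coe, Real.fourier_eq]; rfl

theorem norm_iteratedFDeriv_section_le (G : 𝓢(V × V, F)) (x y : V) (n : ℕ) :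
    ‖iteratedFDeriv ℝ n (schwartzSection G x) y‖ ≤ ‖iteratedFDeriv ℝ n G (x, y)‖ := by
  have h : (schwartzSection G x : V → F) =
      (fun w => G (((x, 0) : V × V) + w)) ∘ ContinuousLinearMap.inr ℝ V V := by
    ext y; simp [schwartzSection_apply]
  have hs : ContDiff ℝ n (fun w => G (((x, 0) : V × V) + w)) :=
    (G.smooth n).comp (contDiff_const.add contDiff_id)
  rw [h, ContinuousLinearMap.iteratedFDeriv_comp_right _ hs _ le_rfl,
    iteratedFDeriv_comp_add_left]
  refine (ContinuousMultilinearMap.norm_compContinuousLinearMap_le _ _).trans ?_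
  have e : ((x, 0) : V × V) + ContinuousLinearMap.inr ℝ V V y = (x, y) := by simp
  rw [e]
  refine mul_le_of_le_one_right (norm_nonneg _) ?_
  refine Finset.prod_le_one (fun _ _ => norm_nonneg _) fun _ _ => ?_
  exact ContinuousLinearMap.norm_inr_le_one ℝ V V

theorem seminorm_section_le (G : 𝓢(V × V, F)) (x : V) (p a b : ℕ) :
    ‖x‖ ^ p * SchwartzMap.seminorm ℂ a b (schwartzSection G x) ≤
      SchwartzMap.seminorm ℂ (a + p) b G := by
  rcases eq_or_lt_of_le (pow_nonneg (norm_nonneg x) p) with h0 | h0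
  · rw [← h0, zero_mul]; exact apply_nonneg _ _
  rw [← le_div_iff₀' h0]
  refine SchwartzMap.seminorm_le_bound ℂ _ _ _ (by positivity) fun y => ?_
  rw [le_div_iff₀' h0]
  refine le_trans ?_ (G.le_seminorm ℂ (a + p) b (x, y))
  have h1 : ‖x‖ ≤ ‖((x, y) : V × V)‖ := norm_fst_le (x, y)
  have h2 : ‖y‖ ≤ ‖((x, y) : V × V)‖ := norm_snd_le (x, y)
  calc ‖x‖ ^ p * (‖y‖ ^ a * ‖iteratedFDeriv ℝ b (schwartzSection G x) y‖)
      ≤ ‖((x, y) : V × V)‖ ^ p * (‖((x, y) : V × V)‖ ^ a * ‖iteratedFDeriv ℝ b G (x, y)‖) := by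
        gcongr
        exact norm_iteratedFDeriv_section_le G x y b
    _ = _ := by ring

theorem partialFourier_decay (G : 𝓢(V × V, F)) (k : ℕ) :
    ∃ C : ℝ, ∀ z : V × V, ‖z‖ ^ k * ‖partialFourier G z‖ ≤ C := by
  have key : ∀ p q : ℕ, ∃ C : ℝ, ∀ z : V × V,
      ‖z.1‖ ^ p * (‖z.2‖ ^ q * ‖partialFourier G z‖) ≤ C := by
    intro p q
    have hc : Continuous
        ((SchwartzMap.seminorm ℂ q 0).comp (fourierTransformCLM ℂ (V := V) (E := F)).toLinearMap) :=
      ((schwartz_withSeminorms ℂ V F).continuous_seminorm (q, 0)).comp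
        (fourierTransformCLM ℂ (V := V) (E := F)).continuous
    obtain ⟨s, C, -, hC⟩ := Seminorm.bound_of_continuous (schwartz_withSeminorms ℂ V F) _ hc
    refine ⟨C * ∑ i ∈ s, SchwartzMap.seminorm ℂ (i.1 + p) i.2 G, fun z => ?_⟩
    have h1 : ‖z.2‖ ^ q * ‖partialFourier G z‖ ≤
        C * ∑ i ∈ s, SchwartzMap.seminorm ℂ i.1 i.2 (schwartzSection G z.1) := by
      rw [partialFourier_eq]
      refine (norm_pow_mul_le_seminorm ℂ (𝓕 (schwartzSection G z.1)) q z.2).trans ?_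
      refine (hC (schwartzSection G z.1)).trans ?_
      change (C : ℝ) * _ ≤ _
      gcongr
      refine (Seminorm.finset_sup_le_sum (schwartzSeminormFamily ℂ V F) s _).trans ?_
      simp [schwartzSeminormFamily]
    calc _ ≤ ‖z.1‖ ^ p *
          (C * ∑ i ∈ s, SchwartzMap.seminorm ℂ i.1 i.2 (schwartzSection G z.1)) := by gcongr
      _ = C * ∑ i ∈ s, ‖z.1‖ ^ p * SchwartzMap.seminorm ℂ i.1 i.2 (schwartzSection G z.1) := by
          rw [Finset.mul_sum, Finset.mul_sum, Finset.mul_sum]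
          exact Finset.sum_congr rfl fun _ _ => by ring
      _ ≤ _ := by
          gcongr with i hi
          exact seminorm_section_le G z.1 p i.1 i.2
  obtain ⟨C₁, h₁⟩ := key k 0
  obtain ⟨C₂, h₂⟩ := key 0 k
  refine ⟨C₁ + C₂, fun z => ?_⟩
  have hz : ‖z‖ ^ k ≤ ‖z.1‖ ^ k + ‖z.2‖ ^ k := by
    rw [Prod.norm_def]
    rcases max_cases ‖z.1‖ ‖z.2‖ with h | h <;> rw [h.1]
    · exact le_add_of_nonneg_right (by positivity)
    · exact le_add_of_nonneg_left (by positivity)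
  have e1 := h₁ z
  have e2 := h₂ z
  simp only [pow_zero, one_mul] at e1 e2
  calc _ ≤ (‖z.1‖ ^ k + ‖z.2‖ ^ k) * ‖partialFourier G z‖ := by gcongr
    _ ≤ _ := by rw [add_mul]; exact add_le_add e1 e2

/-- The derivative of `partialFourier G` is the partial Fourier transform of this function. -/
noncomputable def partialFourierDeriv (G : 𝓢(V × V, F)) : 𝓢(V × V, V × V →L[ℝ] F) :=
  postcompCLM (𝕜 := ℝ) ((ContinuousLinearMap.compL ℝ (V × V) (V × V) F).flip
      ((ContinuousLinearMap.inl ℝ V V).comp (ContinuousLinearMap.fst ℝ V V)))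
      (fderivCLM ℝ (V × V) F G)
  + (-(2 * Real.pi * Complex.I) : ℂ) • smulRightCLM ℂ F
      (((ContinuousLinearMap.compL ℝ (V × V) V ℝ).flip (ContinuousLinearMap.snd ℝ V V)).comp
        ((innerSL ℝ).comp (ContinuousLinearMap.snd ℝ V V))) G

theorem partialFourierDeriv_apply (G : 𝓢(V × V, F)) (x y u v : V) :
    partialFourierDeriv G (x, y) (u, v) =
      fderiv ℝ G (x, y) (u, 0) - (2 * Real.pi * Complex.I : ℂ) • (⟪y, v⟫ : ℝ) • G (x, y) := by
  simp [partialFourierDeriv, sub_eq_add_neg]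

theorem integrable_partialFourier (G : 𝓢(V × V, F)) (z : V × V) :
    Integrable (fun y : V => Real.fourierChar (-⟪y, z.2⟫) • G (z.1, y)) :=
  (Real.fourierIntegral_convergent_iff (V := V) z.2).2
    ((schwartzSection G z.1).integrable (μ := volume))

theorem schwartz_section_bound (G : 𝓢(V × V, F)) (n : ℕ) :
    ∃ c : ℝ, ∀ (w : V × V) (y : V),
      ‖Real.fourierChar (-⟪y, w.2⟫) • G (w.1, y)‖ ≤ c * (1 + ‖y‖) ^ (-(n : ℝ)) := by
  refine ⟨2 ^ n * (Finset.Iic ((n, 0) : ℕ × ℕ)).sup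
    (fun m => SchwartzMap.seminorm ℂ m.1 m.2) G, fun w y => ?_⟩
  have h := one_add_le_sup_seminorm_apply (𝕜 := ℂ) (m := (n, 0)) le_rfl le_rfl G (w.1, y)
  rw [norm_iteratedFDeriv_zero] at h
  rw [Circle.norm_smul]
  have hy : ‖y‖ ≤ ‖((w.1, y) : V × V)‖ := norm_snd_le (w.1, y)
  have hp : 0 < (1 + ‖y‖) ^ n := by positivity
  rw [Real.rpow_neg (by positivity), Real.rpow_natCast, ← div_eq_mul_inv, le_div_iff₀' hp]
  exact le_trans (by gcongr) h

theorem hasFDerivAt_fourierChar_smul (G : 𝓢(V × V, F)) (y : V) (w : V × V)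
    (H : V × V →L[ℝ] F) (hH : ∀ u v : V, H (u, v) =
      fderiv ℝ G (w.1, y) (u, 0) - (2 * Real.pi * Complex.I : ℂ) • (⟪y, v⟫ : ℝ) • G (w.1, y)) :
    HasFDerivAt (fun w : V × V => Real.fourierChar (-⟪y, w.2⟫) • G (w.1, y))
      (Real.fourierChar (-⟪y, w.2⟫) • H) w := by
  have hG : HasFDerivAt (fun w : V × V => G (w.1, y))
      ((fderiv ℝ G (w.1, y)).comp
        ((ContinuousLinearMap.fst ℝ V V).prod (0 : V × V →L[ℝ] V))) w :=
    (G.hasFDerivAt (w.1, y)).comp w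
      ((hasFDerivAt_fst (𝕜 := ℝ) (p := w)).prodMk (hasFDerivAt_const y w))
  have hin : HasFDerivAt (fun w : V × V => -⟪y, w.2⟫)
      (-((innerSL ℝ y).comp (ContinuousLinearMap.snd ℝ V V))) w :=
    (((innerSL ℝ y).comp (ContinuousLinearMap.snd ℝ V V)).hasFDerivAt).neg
  have hch : HasFDerivAt (fun w : V × V => (Real.fourierChar (-⟪y, w.2⟫) : ℂ)) _ w :=
    HasFDerivAt.comp (g := fun t : ℝ => (Real.fourierChar t : ℂ)) w
      (Real.hasDerivAt_fourierChar (-⟪y, w.2⟫)).hasFDerivAt hin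
  have := hch.smul hG
  refine this.congr_fderiv (ContinuousLinearMap.ext fun p => ?_)
  obtain ⟨u, v⟩ := p
  simp only [Circle.smul_def, hH, sub_eq_add_neg, add_apply, smul_apply,
    ContinuousLinearMap.comp_apply, ContinuousLinearMap.smulRight_apply]
  simp
  rw [← Complex.coe_smul, smul_smul, smul_smul]
  congr 1
  ring

theorem hasFDerivAt_partialFourier_aux (G : 𝓢(V × V, F)) (z : V × V)
    (H : V × V → (V × V →L[ℝ] F)) (hH : ∀ x y u v : V, H (x, y) (u, v) =
      fderiv ℝ G (x, y) (u, 0) - (2 * Real.pi * Complex.I : ℂ) • (⟪y, v⟫ : ℝ) • G (x, y))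
    (c : ℝ) (n : ℕ) (hn : Module.finrank ℝ V < n)
    (hc : ∀ (w : V × V) (y : V),
      ‖Real.fourierChar (-⟪y, w.2⟫) • H (w.1, y)‖ ≤ c * (1 + ‖y‖) ^ (-(n : ℝ)))
    (hm : AEStronglyMeasurable (fun y : V => Real.fourierChar (-⟪y, z.2⟫) • H (z.1, y))) :
    HasFDerivAt (partialFourier G)
      (∫ y : V, Real.fourierChar (-⟪y, z.2⟫) • H (z.1, y)) z := by
  have hb : Integrable (fun y : V => c * (1 + ‖y‖) ^ (-(n : ℝ))) :=
    (integrable_one_add_norm (by exact_mod_cast hn)).const_mul c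
  have h1 : ∀ᵐ y : V, ∀ w ∈ (Set.univ : Set (V × V)),
      ‖Real.fourierChar (-⟪y, w.2⟫) • H (w.1, y)‖ ≤ c * (1 + ‖y‖) ^ (-(n : ℝ)) := by
    exact Filter.Eventually.of_forall fun y w _ => hc w y
  have h2 : ∀ᵐ y : V, ∀ w ∈ (Set.univ : Set (V × V)),
      HasFDerivAt (fun w : V × V => Real.fourierChar (-⟪y, w.2⟫) • G (w.1, y))
        (Real.fourierChar (-⟪y, w.2⟫) • H (w.1, y)) w :=
    Filter.Eventually.of_forall fun y w _ =>
      hasFDerivAt_fourierChar_smul G y w (H (w.1, y)) (hH w.1 y)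
  exact hasFDerivAt_integral_of_dominated_of_fderiv_le (𝕜 := ℝ) (μ := volume)
    (F := fun (z : V × V) (y : V) => Real.fourierChar (-⟪y, z.2⟫) • G (z.1, y))
    (F' := fun (z : V × V) (y : V) => Real.fourierChar (-⟪y, z.2⟫) • H (z.1, y))
    Filter.univ_mem
    (Filter.Eventually.of_forall fun z => (integrable_partialFourier G z).1)
    (integrable_partialFourier G z) hm h1 hb h2

theorem hasFDerivAt_partialFourier (G : 𝓢(V × V, F)) (z : V × V) :
    HasFDerivAt (partialFourier G)
      (partialFourier (F := V × V →L[ℝ] F) (partialFourierDeriv G) z) z := by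
  obtain ⟨c, hc⟩ := schwartz_section_bound (F := V × V →L[ℝ] F) (partialFourierDeriv G)
    (Module.finrank ℝ V + 1)
  have hm := (integrable_partialFourier (F := V × V →L[ℝ] F) (partialFourierDeriv G) z).1
  have := hasFDerivAt_partialFourier_aux G z (partialFourierDeriv G)
    (fun x y u v => partialFourierDeriv_apply G x y u v) c _ (Nat.lt_succ_self _) hc hm
  exact this

theorem partialFourier_smooth_decay (n : ℕ) :
    ∀ {F : Type} [NormedAddCommGroup F] [NormedSpace ℂ F] [CompleteSpace F] (G : 𝓢(V × V, F)),
    ContDiff ℝ n (partialFourier G) ∧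
      ∀ k : ℕ, ∃ C : ℝ, ∀ z, ‖z‖ ^ k * ‖iteratedFDeriv ℝ n (partialFourier G) z‖ ≤ C := by
  induction n with
  | zero =>
    intro F _ _ _ G
    refine ⟨?_, fun k => ?_⟩
    · refine contDiff_zero.2 (continuous_iff_continuousAt.2 fun z => ?_)
      exact (hasFDerivAt_partialFourier G z).continuousAt
    · simpa using partialFourier_decay G k
  | succ n ih =>
    intro F _ _ _ G
    have hf : fderiv ℝ (partialFourier G) = partialFourier (F := V × V →L[ℝ] F) (partialFourierDeriv G) :=
      funext fun z => (hasFDerivAt_partialFourier G z).fderiv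
    obtain ⟨h1, h2⟩ := ih (F := V × V →L[ℝ] F) (partialFourierDeriv G)
    refine ⟨?_, fun k => ?_⟩
    · push_cast
      refine contDiff_succ_iff_fderiv.2
        ⟨fun z => (hasFDerivAt_partialFourier G z).differentiableAt, by simp, ?_⟩
      rwa [hf]
    · simpa only [← norm_iteratedFDeriv_fderiv, hf] using h2 k

/-- The partial Fourier transform of a Schwartz function is a Schwartz function. -/
noncomputable def schwartzPartialFourier (G : 𝓢(V × V, F)) : 𝓢(V × V, F) where
  toFun := partialFourier G
  smooth' := contDiff_infty.2 fun n => (partialFourier_smooth_decay n G).1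
  decay' k n := (partialFourier_smooth_decay n G).2 k

theorem schwartzTensor_decay (f g : 𝓢(V, ℂ)) (k n : ℕ) :
    ∃ C : ℝ, ∀ z : V × V,
      ‖z‖ ^ k * ‖iteratedFDeriv ℝ n (fun z : V × V => f z.1 * g z.2) z‖ ≤ C := by
  have hf : ∀ (i : ℕ) (z : V × V), ‖iteratedFDeriv ℝ i (fun z : V × V => f z.1) z‖ ≤
      ‖iteratedFDeriv ℝ i f z.1‖ := by
    intro i z
    have h := ContinuousLinearMap.iteratedFDeriv_comp_right (ContinuousLinearMap.fst ℝ V V)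
      (f.smooth i) z le_rfl
    change ‖iteratedFDeriv ℝ i (f ∘ ContinuousLinearMap.fst ℝ V V) z‖ ≤ _
    rw [h]
    refine (ContinuousMultilinearMap.norm_compContinuousLinearMap_le _ _).trans ?_
    exact mul_le_of_le_one_right (norm_nonneg _) (Finset.prod_le_one (fun _ _ => norm_nonneg _)
      fun _ _ => ContinuousLinearMap.norm_fst_le ℝ V V)
  have hg : ∀ (i : ℕ) (z : V × V), ‖iteratedFDeriv ℝ i (fun z : V × V => g z.2) z‖ ≤
      ‖iteratedFDeriv ℝ i g z.2‖ := by
    intro i z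
    have h := ContinuousLinearMap.iteratedFDeriv_comp_right (ContinuousLinearMap.snd ℝ V V)
      (g.smooth i) z le_rfl
    change ‖iteratedFDeriv ℝ i (g ∘ ContinuousLinearMap.snd ℝ V V) z‖ ≤ _
    rw [h]
    refine (ContinuousMultilinearMap.norm_compContinuousLinearMap_le _ _).trans ?_
    exact mul_le_of_le_one_right (norm_nonneg _) (Finset.prod_le_one (fun _ _ => norm_nonneg _)
      fun _ _ => ContinuousLinearMap.norm_snd_le ℝ V V)
  let p : ℕ → ℕ → 𝓢(V, ℂ) → ℝ := fun a b h => SchwartzMap.seminorm ℝ a b h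
  refine ⟨∑ i ∈ Finset.range (n + 1), (n.choose i : ℝ) *
    (p k i f * p 0 (n - i) g + p 0 i f * p k (n - i) g), fun z => ?_⟩
  have hz : ‖z‖ ^ k ≤ ‖z.1‖ ^ k + ‖z.2‖ ^ k := by
    rw [Prod.norm_def]
    rcases max_cases ‖z.1‖ ‖z.2‖ with h | h <;> rw [h.1]
    · exact le_add_of_nonneg_right (by positivity)
    · exact le_add_of_nonneg_left (by positivity)
  have hm := norm_iteratedFDeriv_mul_le (𝕜 := ℝ) (N := (n : ℕ∞))
    ((f.smooth n).comp contDiff_fst) ((g.smooth n).comp contDiff_snd) z (n := n) le_rfl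
  refine (mul_le_mul_of_nonneg_left hm (by positivity)).trans ?_
  rw [Finset.mul_sum]
  refine Finset.sum_le_sum fun i _ => ?_
  have a1 := f.le_seminorm ℝ k i z.1
  have a2 := f.le_seminorm ℝ 0 i z.1
  have b1 := g.le_seminorm ℝ 0 (n - i) z.2
  have b2 := g.le_seminorm ℝ k (n - i) z.2
  rw [pow_zero, one_mul] at a2 b1
  calc ‖z‖ ^ k * ((n.choose i : ℝ) * ‖iteratedFDeriv ℝ i (fun z : V × V => f z.1) z‖ *
        ‖iteratedFDeriv ℝ (n - i) (fun z : V × V => g z.2) z‖)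
      ≤ (‖z.1‖ ^ k + ‖z.2‖ ^ k) * ((n.choose i : ℝ) * ‖iteratedFDeriv ℝ i f z.1‖ *
        ‖iteratedFDeriv ℝ (n - i) g z.2‖) := by
        gcongr
        · exact hf i z
        · exact hg (n - i) z
    _ = (n.choose i : ℝ) * ((‖z.1‖ ^ k * ‖iteratedFDeriv ℝ i f z.1‖) *
        ‖iteratedFDeriv ℝ (n - i) g z.2‖ + ‖iteratedFDeriv ℝ i f z.1‖ *
        (‖z.2‖ ^ k * ‖iteratedFDeriv ℝ (n - i) g z.2‖)) := by ring
    _ ≤ _ := by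
        have e1 : 0 ≤ p k i f := apply_nonneg _ _
        have e2 : 0 ≤ p 0 i f := apply_nonneg _ _
        gcongr

/-- The tensor product `(x, y) ↦ f x * g y` of two Schwartz functions. -/
noncomputable def schwartzTensor (f g : 𝓢(V, ℂ)) : 𝓢(V × V, ℂ) where
  toFun z := f z.1 * g z.2
  smooth' := ((f.smooth ⊤).comp contDiff_fst).mul ((g.smooth ⊤).comp contDiff_snd)
  decay' := schwartzTensor_decay f g

end PartialFourier

/-- The complex conjugate of a Schwartz function. -/
noncomputable def schwartzConj {E : Type} [NormedAddCommGroup E] [NormedSpace ℝ E]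
    (f : 𝓢(E, ℂ)) : 𝓢(E, ℂ) :=
  postcompCLM (𝕜 := ℝ) (Complex.conjCLE : ℂ →L[ℝ] ℂ) f

theorem schwartzConj_apply {E : Type} [NormedAddCommGroup E] [NormedSpace ℝ E]
    (f : 𝓢(E, ℂ)) (x : E) : schwartzConj f x = conj (f x) := by
  simp [schwartzConj]

/-- The pairing `⟨σ, F⟩` of a tempered distribution with a Schwartz function that extends the
inner product `∫ σ conj F` of `L²`, hence is conjugate-linear in `F`. -/
noncomputable def sesqPairing {E : Type} [NormedAddCommGroup E] [NormedSpace ℝ E]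
    (σ : 𝓢'(E, ℂ)) (F : 𝓢(E, ℂ)) : ℂ :=
  σ (schwartzConj F)

section TimeFrequency

variable {ι : Type} [Fintype ι]

theorem hasTemperateGrowth_modulation (ω : EuclideanSpace ℝ ι) :
    (fun t : EuclideanSpace ℝ ι => (Real.fourierChar ⟪t, ω⟫ : ℂ)).HasTemperateGrowth := by
  have hn : ∀ n : ℕ, iteratedDeriv n (fun t : ℝ => (Real.fourierChar t : ℂ)) =
      fun t => (2 * Real.pi * Complex.I) ^ n * (Real.fourierChar t : ℂ) := by
    intro n
    induction n with
    | zero => simp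
    | succ n ih =>
      rw [iteratedDeriv_succ, ih]
      ext t
      rw [((Real.hasDerivAt_fourierChar t).const_mul _).deriv]
      ring
  have hc : ContDiff ℝ (⊤ : ℕ∞) (fun t : ℝ => (Real.fourierChar t : ℂ)) := by
    simp only [Real.fourierChar_apply]
    exact (((Complex.ofRealCLM.contDiff).comp (contDiff_const.mul contDiff_id)).mul
      contDiff_const).cexp
  have h : (fun t : ℝ => (Real.fourierChar t : ℂ)).HasTemperateGrowth := by
    refine ⟨hc, fun n => ⟨0, (2 * Real.pi) ^ n, fun t => ?_⟩⟩
    rw [norm_iteratedFDeriv_eq_norm_iteratedDeriv, hn]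
    rw [norm_mul, Circle.norm_coe]
    simp [abs_of_pos Real.pi_pos]
  exact h.comp (Function.hasTemperateGrowth_inner_left ω)

/-- The time-frequency shift `π(x, ω) g = M_ω T_x g`. -/
noncomputable def timeFreqShift (x ω : EuclideanSpace ℝ ι) (g : 𝓢(EuclideanSpace ℝ ι, ℂ)) :
    𝓢(EuclideanSpace ℝ ι, ℂ) :=
  smulLeftCLM ℂ (fun t : EuclideanSpace ℝ ι => (Real.fourierChar ⟪t, ω⟫ : ℂ))
    (compSubConstCLM ℂ x g)

theorem timeFreqShift_apply (x ω : EuclideanSpace ℝ ι) (g : 𝓢(EuclideanSpace ℝ ι, ℂ))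
    (t : EuclideanSpace ℝ ι) :
    timeFreqShift x ω g t = Complex.exp (2 * Real.pi * Complex.I * ⟪t, ω⟫) * g (t - x) := by
  rw [timeFreqShift, smulLeftCLM_apply_apply (hasTemperateGrowth_modulation ω),
    compSubConstCLM_apply, smul_eq_mul, Real.fourierChar_apply]
  push_cast
  congr 2
  ring

/-- The short-time Fourier transform `V_g u(x, ω) = ⟨u, π(x, ω) g⟩` of a tempered distribution. -/
noncomputable def stft (g : 𝓢(EuclideanSpace ℝ ι, ℂ)) (u : 𝓢'(EuclideanSpace ℝ ι, ℂ))
    (x ω : EuclideanSpace ℝ ι) : ℂ :=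
  sesqPairing u (timeFreqShift x ω g)

/-- The norm `‖u‖_{M¹} = ∫∫ |V_g u(x, ω)| dx dω`, computed with the window `g`. -/
noncomputable def modulationNorm (g : 𝓢(EuclideanSpace ℝ ι, ℂ)) (u : 𝓢'(EuclideanSpace ℝ ι, ℂ)) :
    ℝ≥0∞ :=
  ∫⁻ z : EuclideanSpace ℝ ι × EuclideanSpace ℝ ι, ‖stft g u z.1 z.2‖ₑ

/-- Membership in the modulation space `M¹`: tempered distributions `u` with `V_g u ∈ L¹`,
for the fixed non-zero window `g`. -/
def MemModulationOne (g : 𝓢(EuclideanSpace ℝ ι, ℂ)) (u : 𝓢'(EuclideanSpace ℝ ι, ℂ)) : Prop :=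
  modulationNorm g u < ⊤

end TimeFrequency

section MatrixWigner

variable {d : ℕ}

/-- The identification of `ℝ^{2d}` with `ℝ^d × ℝ^d`. -/
noncomputable def splitEquiv (d : ℕ) : EuclideanSpace ℝ (Fin d ⊕ Fin d) ≃L[ℝ]
    EuclideanSpace ℝ (Fin d) × EuclideanSpace ℝ (Fin d) :=
  LinearEquiv.toContinuousLinearEquiv
    { toFun := fun z => (WithLp.toLp 2 fun i => z (Sum.inl i), WithLp.toLp 2 fun i => z (Sum.inr i))
      invFun := fun p => WithLp.toLp 2 (Sum.elim p.1 p.2)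
      map_add' := fun _ _ => rfl
      map_smul' := fun _ _ => rfl
      left_inv := fun z => by ext (i | i) <;> rfl
      right_inv := fun p => rfl }

/-- The action `(x, y) ↦ (A₁₁ x + A₁₂ y, A₂₁ x + A₂₂ y)` of an invertible matrix. -/
noncomputable def blockEquiv (A : GL (Fin d ⊕ Fin d) ℝ) :
    (EuclideanSpace ℝ (Fin d) × EuclideanSpace ℝ (Fin d)) ≃L[ℝ]
      EuclideanSpace ℝ (Fin d) × EuclideanSpace ℝ (Fin d) :=
  ((splitEquiv d).symm.trans (LinearEquiv.toContinuousLinearEquiv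
    (LinearEquiv.ofLinearMap (Matrix.toEuclideanLin (A : Matrix (Fin d ⊕ Fin d) (Fin d ⊕ Fin d) ℝ))
      (Matrix.toEuclideanLin ((A⁻¹ : GL (Fin d ⊕ Fin d) ℝ) : Matrix (Fin d ⊕ Fin d) (Fin d ⊕ Fin d) ℝ))
      (by simp [Matrix.toEuclideanLin, ← Matrix.toLpLin_mul_same])
      (by simp [Matrix.toEuclideanLin, ← Matrix.toLpLin_mul_same])))).trans (splitEquiv d)

theorem blockEquiv_apply (A : GL (Fin d ⊕ Fin d) ℝ) (x y : EuclideanSpace ℝ (Fin d)) :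
    blockEquiv A (x, y) =
      (Matrix.toEuclideanLin A.1.toBlocks₁₁ x + Matrix.toEuclideanLin A.1.toBlocks₁₂ y,
       Matrix.toEuclideanLin A.1.toBlocks₂₁ x + Matrix.toEuclideanLin A.1.toBlocks₂₂ y) := by
  have h : ∀ i, (Matrix.toEuclideanLin A.1 ((splitEquiv d).symm (x, y))) i =
      Sum.elim (A.1.toBlocks₁₁.mulVec x + A.1.toBlocks₁₂.mulVec y)
        (A.1.toBlocks₂₁.mulVec x + A.1.toBlocks₂₂.mulVec y) i := by
    intro i
    conv_lhs => rw [← A.1.fromBlocks_toBlocks]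
    rw [Matrix.toLpLin_apply]
    change (Matrix.mulVec _ (Sum.elim x y)) i = _
    rw [Matrix.fromBlocks_mulVec]
    rfl
  refine Prod.ext (PiLp.ext fun i => ?_) (PiLp.ext fun i => ?_)
  · exact h (Sum.inl i)
  · exact h (Sum.inr i)

/-- The matrix-Wigner distribution
`B_A(f, g)(x, ω) = ∫ e^{-2πi ω·y} f(A₁₁ x + A₁₂ y) conj (g(A₂₁ x + A₂₂ y)) dy`,
that is, `F₂ T_A (f ⊗ conj g)`. -/
noncomputable def matrixWigner (A : GL (Fin d ⊕ Fin d) ℝ) (f g : 𝓢(EuclideanSpace ℝ (Fin d), ℂ)) :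
    𝓢(EuclideanSpace ℝ (Fin d ⊕ Fin d), ℂ) :=
  compCLMOfContinuousLinearEquiv ℂ (splitEquiv d) <| schwartzPartialFourier <|
    compCLMOfContinuousLinearEquiv ℂ (blockEquiv A) <| schwartzTensor f (schwartzConj g)

theorem matrixWigner_apply (A : GL (Fin d ⊕ Fin d) ℝ) (f g : 𝓢(EuclideanSpace ℝ (Fin d), ℂ))
    (z : EuclideanSpace ℝ (Fin d ⊕ Fin d)) :
    matrixWigner A f g z = ∫ y : EuclideanSpace ℝ (Fin d),
      Complex.exp (-2 * Real.pi * Complex.I * ⟪(splitEquiv d z).2, y⟫) *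
        f (Matrix.toEuclideanLin A.1.toBlocks₁₁ (splitEquiv d z).1 +
          Matrix.toEuclideanLin A.1.toBlocks₁₂ y) *
        conj (g (Matrix.toEuclideanLin A.1.toBlocks₂₁ (splitEquiv d z).1 +
          Matrix.toEuclideanLin A.1.toBlocks₂₂ y)) := by
  change ∫ y : EuclideanSpace ℝ (Fin d), Real.fourierChar (-⟪y, (splitEquiv d z).2⟫) •
    (f (blockEquiv A ((splitEquiv d z).1, y)).1 *
      schwartzConj g (blockEquiv A ((splitEquiv d z).1, y)).2) = _
  refine integral_congr_ae (Filter.Eventually.of_forall fun y => ?_)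
  simp only [blockEquiv_apply, schwartzConj_apply, Circle.smul_def, Real.fourierChar_apply,
    smul_eq_mul, ← mul_assoc]
  rw [real_inner_comm]
  congr 3
  push_cast
  ring_nf

/-- `T` is the operator `σ^A` on `L²(ℝ^d)`: `⟨T f, g⟩ = ⟨σ, B_A(g, f)⟩` for all Schwartz functions
`f` and `g`. The inner product of Mathlib is conjugate-linear in its first argument. -/
def IsMatrixQuantization (A : GL (Fin d ⊕ Fin d) ℝ)
    (σ : 𝓢'(EuclideanSpace ℝ (Fin d ⊕ Fin d), ℂ))
    (T : Lp ℂ 2 (volume : Measure (EuclideanSpace ℝ (Fin d))) →L[ℂ]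
      Lp ℂ 2 (volume : Measure (EuclideanSpace ℝ (Fin d)))) : Prop :=
  ∀ f g : 𝓢(EuclideanSpace ℝ (Fin d), ℂ),
    inner ℂ (g.toLp 2 volume) (T (f.toLp 2 volume)) = sesqPairing σ (matrixWigner A g f)

end MatrixWigner

section TraceClass

variable {H : Type} [NormedAddCommGroup H] [InnerProductSpace ℂ H] [CompleteSpace H]

/-- The trace norm `‖T‖_{S¹} = Tr |T| = ∑ ⟨|T| bᵢ, bᵢ⟩ ∈ [0, ∞]` with `|T| = (T* T)^{1/2}`. The sum
does not depend on the orthonormal basis; the supremum over all of them avoids a choice. -/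
noncomputable def traceNorm (T : H →L[ℂ] H) : ℝ≥0∞ :=
  ⨆ (w : Set H) (b : HilbertBasis w ℂ H),
    ∑' i : w, ENNReal.ofReal (RCLike.re (inner ℂ (b i) (CFC.abs T (b i))))

/-- The trace class. -/
def IsTraceClass (T : H →L[ℂ] H) : Prop :=
  traceNorm T < ⊤

end TraceClass

/-! Writing `w` for a point of phase space, `π(w)` for the time-frequency shift and `γ` for a second
window with `c = ∫ Φ conj γ ≠ 0`, the inversion formula reads `conj c · ⟨σ, F⟩ = ∫ V_Φ σ(w) conj
(V_γ F(w)) dw`. The choice `γ = B_A(f₀, g₀)` makes this formula produce operators of rank one.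
Covariance gives `π(w) B_A(f₀, g₀) = φ(w) B_A(u_w, v_w)`, with `|φ(w)| = 1` and `u_w`, `v_w`
time-frequency shifts of `f₀`, `g₀`. For `F = B_A(g, f)`, Moyal's identity turns `conj (V_γ F(w))`
into `κ φ(w)` times a product of one inner product with `g` and one with `f`. Hence `σ^A = (κ / conj
c) ∫ φ(w) V_Φ σ(w) (u_w ⊗ v_w*) dw`. This converges in operator norm when `V_Φ σ` is integrable, and
its trace norm is at most a constant times `‖f₀‖ ‖g₀‖ ‖σ‖_{M¹}`. Uniqueness is density of the
Schwartz functions in `L²`.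

The main ingredients are `traceNorm_integral_smul_rankOne_le`, `integral_stft_mul` (inversion for
distributions, resting on `apply_eq_integral_of_forall_eq_integral`),
`exists_integral_matrixWigner_mul_conj`, `timeFreqShift_matrixWigner`, and
`exists_integral_mul_conj_matrixWigner_ne_zero`, which supplies `f₀`, `g₀` for an arbitrary `Φ ≠ 0`.
-/

/-! ### Trace norm of integrals of rank-one operators. -/

section TraceNorm

variable {H : Type} [NormedAddCommGroup H] [InnerProductSpace ℂ H] [CompleteSpace H]

/-- An approximate polar decomposition: up to `ε`, the diagonal of `|T|` is bounded by that of
`U† T` for a contraction `U`. -/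
theorem exists_contraction_inner_abs_le (T : H →L[ℂ] H) {ε : ℝ} (hε : 0 < ε) :
    ∃ U : H →L[ℂ] H, ‖U‖ ≤ 1 ∧ ∀ b : H,
      RCLike.re (inner ℂ b (CFC.abs T b)) ≤
        RCLike.re (inner ℂ (U b) (T b)) + ε * ‖b‖ ^ 2 := by
  set P : H →L[ℂ] H := CFC.abs T
  have hP0 : 0 ≤ P := CFC.abs_nonneg T
  have hPpos : P.IsPositive := (ContinuousLinearMap.nonneg_iff_isPositive P).1 hP0
  have hsym : ∀ x y, inner ℂ (P x) y = inner ℂ x (P y) := hPpos.isSymmetric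
  have hPP : ∀ x y, inner ℂ (T x) (T y) = inner ℂ (P x) (P y) := by
    intro x y
    have h : P * P = star T * T := CFC.abs_mul_abs T
    have h2 := congrArg (fun S : H →L[ℂ] H => inner ℂ x (S y)) h
    rw [← ContinuousLinearMap.adjoint_inner_right, hsym]
    exact h2.symm
  -- Since `P ≥ 0`, `P + ε` has an inverse `R`. The contraction is `U = T R`, which replaces the
  -- partial isometry of the polar decomposition at the cost of an error term `ε P R`.
  have hu : IsUnit (P + algebraMap ℝ (H →L[ℂ] H) ε) := by
    have h1 : -ε ∉ spectrum ℝ P := fun h => by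
      have := spectrum_nonneg_of_nonneg hP0 h
      linarith
    rw [spectrum.notMem_iff] at h1
    have h2 := h1.neg
    rwa [map_neg, neg_sub, sub_neg_eq_add] at h2
  obtain ⟨S, hS⟩ := hu
  set R : H →L[ℂ] H := ((S⁻¹ : (H →L[ℂ] H)ˣ) : H →L[ℂ] H) with hR
  have hSR : ∀ x, P (R x) + (ε : ℂ) • R x = x := by
    intro x
    have h : (P + algebraMap ℝ (H →L[ℂ] H) ε) * R = 1 := by rw [← hS, hR, Units.mul_inv]
    have h2 := congrArg (fun S : H →L[ℂ] H => S x) h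
    simpa [Algebra.algebraMap_eq_smul_one] using h2
  have hPR : ∀ x, ‖P (R x)‖ ≤ ‖x‖ := by
    intro x
    -- In the expansion of `‖P R x + ε R x‖² = ‖x‖²` the cross term is non-negative and can be
    -- dropped.
    have h0 : 0 ≤ RCLike.re (inner ℂ (P (R x)) (R x)) := hPpos.re_inner_nonneg_left _
    have h1 : ‖P (R x) + (ε : ℂ) • R x‖ ^ 2 = ‖x‖ ^ 2 := by rw [hSR]
    rw [@norm_add_sq ℂ, inner_smul_right, ← RCLike.ofReal_eq_complex_ofReal,
      RCLike.re_ofReal_mul] at h1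
    refine le_of_sq_le_sq ?_ (norm_nonneg _)
    have := mul_nonneg hε.le h0
    nlinarith [sq_nonneg ‖((ε : ℝ) : ℂ) • R x‖]
  refine ⟨T ∘L R, ?_, fun b => ?_⟩
  · refine ContinuousLinearMap.opNorm_le_bound _ zero_le_one fun x => ?_
    rw [one_mul]
    refine le_trans (le_of_eq ?_) (hPR x)
    have h := hPP (R x) (R x)
    rw [inner_self_eq_norm_sq_to_K, inner_self_eq_norm_sq_to_K] at h
    have h' : ‖T (R x)‖ ^ 2 = ‖P (R x)‖ ^ 2 := by exact_mod_cast h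
    exact (sq_eq_sq₀ (norm_nonneg _) (norm_nonneg _)).1 h'
  · have e1 : inner ℂ (T (R b)) (T b) = inner ℂ b (P b) - (ε : ℂ) * inner ℂ (P (R b)) b := by
      rw [hPP]
      have h3 : P (R b) = b - (ε : ℂ) • R b := eq_sub_of_add_eq (hSR b)
      conv_lhs => rw [h3]
      rw [inner_sub_left, inner_smul_left, Complex.conj_ofReal, hsym (R b) b]
    have e2 : RCLike.re (inner ℂ (P (R b)) b) ≤ ‖b‖ ^ 2 := by
      refine (re_inner_le_norm _ _).trans ?_
      nlinarith [hPR b, norm_nonneg b]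
    change _ ≤ RCLike.re (inner ℂ (T (R b)) (T b)) + _
    rw [e1, map_sub, ← RCLike.ofReal_eq_complex_ofReal, RCLike.re_ofReal_mul]
    nlinarith

/-- Cauchy–Schwarz for the sum, then Bessel for each factor. This bounds the partial traces of a
rank-one operator uniformly in the orthonormal system. -/
theorem sum_norm_inner_mul_inner_le {ι : Type*} {b : ι → H} (hb : Orthonormal ℂ b)
    (s : Finset ι) (x y : H) :
    ∑ i ∈ s, ‖inner ℂ (b i) x‖ * ‖inner ℂ (b i) y‖ ≤ ‖x‖ * ‖y‖ := by
  refine (Real.sum_mul_le_sqrt_mul_sqrt s _ _).trans ?_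
  refine mul_le_mul ?_ ?_ (Real.sqrt_nonneg _) (norm_nonneg _)
  · exact Real.sqrt_le_iff.2 ⟨norm_nonneg _, hb.sum_inner_products_le x⟩
  · exact Real.sqrt_le_iff.2 ⟨norm_nonneg _, hb.sum_inner_products_le y⟩

variable {α : Type} [MeasurableSpace α] {μ : Measure α}

theorem integrable_smul_rankOne {a : α → ℂ} (ha : Integrable a μ) {u v : α → H}
    (hu : AEStronglyMeasurable u μ) (hv : AEStronglyMeasurable v μ) {M N : ℝ}
    (hM : ∀ w, ‖u w‖ ≤ M) (hN : ∀ w, ‖v w‖ ≤ N) :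
    Integrable (fun w => a w • InnerProductSpace.rankOne ℂ (u w) (v w)) μ := by
  have hm : AEStronglyMeasurable (fun w => InnerProductSpace.rankOne ℂ (u w) (v w)) μ := by
    have hc : Continuous fun p : H × H => InnerProductSpace.rankOne ℂ p.1 p.2 :=
      (ContinuousLinearMap.smulRightL ℂ H H).continuous₂.comp
        (((innerSL ℂ).continuous.comp continuous_snd).prodMk continuous_fst)
    have key : ∀ r : H × H → (H →L[ℂ] H), Continuous r →
        AEStronglyMeasurable (fun w => r (u w, v w)) μ :=
      fun r hr => hr.comp_aestronglyMeasurable (hu.prodMk hv)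
    exact key _ hc
  refine ha.smul_bdd (M * N) hm (Filter.Eventually.of_forall fun w => ?_)
  rw [InnerProductSpace.norm_rankOne]
  exact mul_le_mul (hM w) (hN w) (norm_nonneg _) ((norm_nonneg _).trans (hM w))

theorem inner_integral_smul_rankOne_apply {a : α → ℂ} (ha : Integrable a μ) {u v : α → H}
    (hu : AEStronglyMeasurable u μ) (hv : AEStronglyMeasurable v μ) {M N : ℝ}
    (hM : ∀ w, ‖u w‖ ≤ M) (hN : ∀ w, ‖v w‖ ≤ N) (x y : H) :
    Integrable (fun w => inner ℂ x (u w) * (inner ℂ (v w) y * a w)) μ ∧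
      inner ℂ x ((∫ w, a w • InnerProductSpace.rankOne ℂ (u w) (v w) ∂μ) y) =
        ∫ w, inner ℂ x (u w) * (inner ℂ (v w) y * a w) ∂μ := by
  have hint := integrable_smul_rankOne ha hu hv hM hN
  have h1 := (ContinuousLinearMap.apply ℂ H y).integrable_comp hint
  have h2 := (innerSL ℂ x).integrable_comp h1
  have e : ∀ w, innerSL ℂ x (ContinuousLinearMap.apply ℂ H y
      (a w • InnerProductSpace.rankOne ℂ (u w) (v w))) =
      inner ℂ x (u w) * (inner ℂ (v w) y * a w) := by
    intro w
    simp
    ring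
  refine ⟨h2.congr (Filter.Eventually.of_forall e), ?_⟩
  rw [ContinuousLinearMap.integral_apply hint]
  exact ((innerSL ℂ x).integral_comp_comm h1).symm.trans
    (integral_congr_ae (Filter.Eventually.of_forall e))

/-- The trace norm of an integral of operators of rank one is at most the integral of their trace
norms. -/
theorem traceNorm_integral_smul_rankOne_le {a : α → ℂ} (ha : Integrable a μ) {u v : α → H}
    (hu : AEStronglyMeasurable u μ) (hv : AEStronglyMeasurable v μ) {M N : ℝ}
    (hM : ∀ w, ‖u w‖ ≤ M) (hN : ∀ w, ‖v w‖ ≤ N) (hM0 : 0 ≤ M) :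
    traceNorm (∫ w, a w • InnerProductSpace.rankOne ℂ (u w) (v w) ∂μ) ≤
      ENNReal.ofReal (M * N) * ∫⁻ w, ‖a w‖ₑ ∂μ := by
  set T := ∫ w, a w • InnerProductSpace.rankOne ℂ (u w) (v w) ∂μ with hT
  rw [← ofReal_integral_norm_eq_lintegral_enorm ha,
    mul_comm (ENNReal.ofReal _), ← ENNReal.ofReal_mul (integral_nonneg fun _ => norm_nonneg _)]
  set K := (∫ w, ‖a w‖ ∂μ) * (M * N) with hK
  have hTi := inner_integral_smul_rankOne_apply ha hu hv hM hN
  refine iSup_le fun s => iSup_le fun b => ?_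
  refine ENNReal.summable.tsum_le_of_sum_le fun t => ?_
  have hPpos : (CFC.abs T).IsPositive :=
    (ContinuousLinearMap.nonneg_iff_isPositive _).1 (CFC.abs_nonneg T)
  rw [← ENNReal.ofReal_sum_of_nonneg fun i _ => hPpos.re_inner_nonneg_right _]
  refine ENNReal.ofReal_le_ofReal (le_of_forall_pos_le_add fun δ hδ => ?_)
  -- The polar decomposition costs `ε` per basis vector, hence at most `δ` over `t`; the `+ 1`
  -- covers empty `t`.
  set ε := δ / (t.card + 1) with hεd
  have hε : 0 < ε := by positivity
  obtain ⟨U, hU, hUb⟩ := exists_contraction_inner_abs_le T hε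
  -- The sum is finite, so it passes under the integral. Moving `U` to `u w` by its adjoint leaves
  -- two coefficients in the same orthonormal system.
  have hmain : ∑ i ∈ t, RCLike.re (inner ℂ (U (b i)) (T (b i))) ≤ K := by
    rw [← map_sum]
    refine (RCLike.re_le_norm _).trans ?_
    simp_rw [hT, fun i => (hTi (U (b i)) (b i)).2]
    rw [← integral_finsetSum _ fun i _ => (hTi (U (b i)) (b i)).1, hK, ← integral_mul_const]
    refine norm_integral_le_of_norm_le (ha.norm.mul_const _)
      (Filter.Eventually.of_forall fun w => ?_)
    calc ‖∑ i ∈ t, inner ℂ (U (b i)) (u w) * (inner ℂ (v w) (b i) * a w)‖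
        ≤ ∑ i ∈ t, ‖inner ℂ (U (b i)) (u w) * (inner ℂ (v w) (b i) * a w)‖ := norm_sum_le _ _
      _ = ‖a w‖ * ∑ i ∈ t, ‖inner ℂ (b i) (U.adjoint (u w))‖ * ‖inner ℂ (b i) (v w)‖ := by
          rw [Finset.mul_sum]
          refine Finset.sum_congr rfl fun i _ => ?_
          rw [norm_mul, norm_mul, ContinuousLinearMap.adjoint_inner_right, norm_inner_symm (v w)]
          ring
      _ ≤ ‖a w‖ * (‖U.adjoint (u w)‖ * ‖v w‖) := by
          gcongr
          exact sum_norm_inner_mul_inner_le b.orthonormal t _ _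
      _ ≤ ‖a w‖ * (M * N) := by
          gcongr
          · refine (U.adjoint.le_opNorm _).trans ?_
            rw [LinearIsometryEquiv.norm_map]
            nlinarith [hM w, norm_nonneg (u w), norm_nonneg U]
          · exact hN w
  calc ∑ i ∈ t, RCLike.re (inner ℂ (b i) (CFC.abs T (b i)))
      ≤ ∑ i ∈ t, (RCLike.re (inner ℂ (U (b i)) (T (b i))) + ε * ‖b i‖ ^ 2) :=
        Finset.sum_le_sum fun i _ => hUb _
    _ = ∑ i ∈ t, RCLike.re (inner ℂ (U (b i)) (T (b i))) + t.card * ε := by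
        simp [Finset.sum_add_distrib, b.orthonormal.norm_eq_one]
    _ ≤ K + δ := by
        refine add_le_add hmain ?_
        rw [hεd, mul_div_assoc', div_le_iff₀ (by positivity)]
        nlinarith

end TraceNorm

/-! ### Translations on the Schwartz space. -/

section Translation

variable {V : Type} [NormedAddCommGroup V] [NormedSpace ℝ V]

theorem continuous_finset_sup_seminorm (s : Finset (ℕ × ℕ)) :
    Continuous (s.sup fun m => SchwartzMap.seminorm ℂ m.1 m.2 : Seminorm ℂ 𝓢(V, ℂ)) := by
  refine Finset.sup_induction (p := fun q : Seminorm ℂ 𝓢(V, ℂ) => Continuous q)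
    continuous_zero (fun a ha b hb => ha.max hb)
    fun i _ => (schwartz_withSeminorms ℂ V ℂ).continuous_seminorm i

theorem exists_seminorm_le_sup_Iic (p : Seminorm ℂ 𝓢(V, ℂ)) (hp : Continuous p) :
    ∃ (C : NNReal) (m : ℕ × ℕ),
      p ≤ C • (Finset.Iic m).sup fun m => SchwartzMap.seminorm ℂ m.1 m.2 := by
  obtain ⟨s, C, -, hC⟩ := Seminorm.bound_of_continuous (schwartz_withSeminorms ℂ V ℂ) p hp
  refine ⟨C, (s.sup Prod.fst, s.sup Prod.snd), hC.trans ?_⟩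
  gcongr
  refine Finset.sup_mono fun i hi => Finset.mem_Iic.2 ⟨?_, ?_⟩
  · exact Finset.le_sup (f := Prod.fst) hi
  · exact Finset.le_sup (f := Prod.snd) hi

theorem iteratedFDeriv_compSubConst (g : 𝓢(V, ℂ)) (n : ℕ) (z t : V) :
    iteratedFDeriv ℝ n (compSubConstCLM ℂ z g) t = iteratedFDeriv ℝ n g (t - z) :=
  iteratedFDeriv_comp_sub n z t

/-- The weight obeys `‖t‖ ≤ (1 + ‖z‖)(1 + ‖t - z‖)`. Allowing any continuous seminorm lets the bound
be applied again after a Fourier transform. -/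
theorem seminorm_compSubConst_le (p : Seminorm ℂ 𝓢(V, ℂ)) (hp : Continuous p) :
    ∃ (K : ℕ) (q : Seminorm ℂ 𝓢(V, ℂ)), Continuous q ∧
      ∀ z g, p (compSubConstCLM ℂ z g) ≤ (1 + ‖z‖) ^ K * q g := by
  obtain ⟨C, m, hC⟩ := exists_seminorm_le_sup_Iic p hp
  set P : Seminorm ℂ 𝓢(V, ℂ) := (Finset.Iic m).sup fun m => SchwartzMap.seminorm ℂ m.1 m.2
  refine ⟨m.1, (C * 2 ^ m.1) • P, (continuous_finset_sup_seminorm _).const_smul (C * 2 ^ m.1),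
    fun z g => ?_⟩
  refine (hC _).trans ?_
  have h : P (compSubConstCLM ℂ z g) ≤ (1 + ‖z‖) ^ m.1 * (2 ^ m.1 * P g) := by
    refine Seminorm.finset_sup_apply_le (by positivity) fun i hi => ?_
    obtain ⟨h1, h2⟩ := Finset.mem_Iic.1 hi
    refine SchwartzMap.seminorm_le_bound ℂ _ _ _ (by positivity) fun t => ?_
    rw [iteratedFDeriv_compSubConst]
    have h3 := one_add_le_sup_seminorm_apply (𝕜 := ℂ) (m := m) le_rfl h2 g (t - z)
    have h4 : ‖t‖ ≤ (1 + ‖z‖) * (1 + ‖t - z‖) := by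
      have := norm_add_le z (t - z)
      rw [add_sub_cancel] at this
      nlinarith [norm_nonneg z, norm_nonneg (t - z)]
    calc ‖t‖ ^ i.1 * ‖iteratedFDeriv ℝ i.2 g (t - z)‖
        ≤ ((1 + ‖z‖) * (1 + ‖t - z‖)) ^ i.1 * ‖iteratedFDeriv ℝ i.2 g (t - z)‖ := by gcongr
      _ ≤ ((1 + ‖z‖) * (1 + ‖t - z‖)) ^ m.1 * ‖iteratedFDeriv ℝ i.2 g (t - z)‖ := by
          gcongr ?_ * _
          exact pow_le_pow_right₀ (by nlinarith [norm_nonneg z, norm_nonneg (t - z)]) h1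
      _ = (1 + ‖z‖) ^ m.1 * ((1 + ‖t - z‖) ^ m.1 * ‖iteratedFDeriv ℝ i.2 g (t - z)‖) := by
          rw [mul_pow]; ring
      _ ≤ _ := by gcongr
  change (C : ℝ) * P _ ≤ (1 + ‖z‖) ^ m.1 * ((C * 2 ^ m.1) * P g)
  calc (C : ℝ) * P (compSubConstCLM ℂ z g) ≤ C * ((1 + ‖z‖) ^ m.1 * (2 ^ m.1 * P g)) := by gcongr
    _ = _ := by ring

/-- Mean value inequality for the `n`-th derivative on the ball of radius `‖h‖` about `t`. As `‖h‖ ≤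
1`, points `x` of the ball satisfy `‖t‖ ≤ 1 + ‖x‖`, so the weight may be moved to `x`. -/
theorem seminorm_compSubConst_sub_le (g : 𝓢(V, ℂ)) (k n : ℕ) :
    ∃ M : ℝ, ∀ h : V, ‖h‖ ≤ 1 →
      SchwartzMap.seminorm ℂ k n (compSubConstCLM ℂ h g - g) ≤ M * ‖h‖ := by
  set S : ℝ := 2 ^ k * ((Finset.Iic (k, n + 1)).sup fun m => SchwartzMap.seminorm ℂ m.1 m.2) g
  have hS : 0 ≤ S := by positivity
  refine ⟨S, fun h hh => ?_⟩
  refine SchwartzMap.seminorm_le_bound ℂ _ _ _ (by positivity) fun t => ?_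
  rcases eq_or_lt_of_le (pow_nonneg (norm_nonneg t) k) with h0 | h0
  · rw [← h0, zero_mul]; positivity
  have e : iteratedFDeriv ℝ n (compSubConstCLM ℂ h g - g) t =
      iteratedFDeriv ℝ n g (t - h) - iteratedFDeriv ℝ n g t := by
    rw [← iteratedFDeriv_compSubConst]
    exact iteratedFDeriv_sub_apply ((compSubConstCLM ℂ h g).contDiffAt n) (g.contDiffAt n)
  rw [e, ← le_div_iff₀' h0, mul_div_right_comm]
  have hd : Differentiable ℝ (iteratedFDeriv ℝ n g) :=
    (g.smooth (n + 1 : ℕ)).differentiable_iteratedFDeriv (by exact_mod_cast Nat.lt_succ_self n)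
  have key := Convex.norm_image_sub_le_of_norm_fderiv_le (𝕜 := ℝ) (f := iteratedFDeriv ℝ n g)
    (C := S / ‖t‖ ^ k) (s := Metric.closedBall t ‖h‖) (x := t) (y := t - h)
    (fun x _ => hd x) (fun x hx => ?_) (convex_closedBall _ _) (by simp) (by simp)
  · simpa using key
  · rw [norm_fderiv_iteratedFDeriv, le_div_iff₀' h0]
    refine le_trans ?_ (one_add_le_sup_seminorm_apply (𝕜 := ℂ) (m := (k, n + 1)) le_rfl le_rfl g x)
    gcongr
    have h1 : ‖x - t‖ ≤ 1 := by simpa [dist_eq_norm] using (Metric.mem_closedBall.1 hx).trans hh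
    have h2 := norm_sub_norm_le t x
    rw [norm_sub_rev] at h2
    linarith

/-- Translation is continuous on the Schwartz space. -/
theorem continuous_compSubConst (g : 𝓢(V, ℂ)) :
    Continuous fun z : V => compSubConstCLM ℂ z g := by
  have h0 : Filter.Tendsto (fun h : V => compSubConstCLM ℂ h g) (nhds 0) (nhds g) := by
    rw [(schwartz_withSeminorms ℂ V ℂ).tendsto_nhds]
    rintro ⟨k, n⟩ ε hε
    obtain ⟨M, hM⟩ := seminorm_compSubConst_sub_le g k n
    have ht : Filter.Tendsto (fun h : V => M * ‖h‖) (nhds 0) (nhds 0) := by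
      have : Continuous fun h : V => M * ‖h‖ := by fun_prop
      simpa using this.tendsto 0
    filter_upwards [ht.eventually_lt_const hε, Metric.closedBall_mem_nhds (0 : V) one_pos]
      with h h1 h2
    exact (hM h (by simpa using h2)).trans_lt h1
  refine continuous_iff_continuousAt.2 fun z => ?_
  have h1 : Filter.Tendsto (fun w : V => w - z) (nhds z) (nhds 0) :=
    (continuous_sub_right z).tendsto' z 0 (sub_self z)
  have h2 := ((compSubConstCLM ℂ z (F := ℂ)).continuous.tendsto g).comp (h0.comp h1)
  refine h2.congr fun w => ?_
  simp [compSubConstCLM_comp]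

end Translation

/-! ### Regularity and growth of time-frequency shifts. -/

section TimeFrequencyShift

variable {ι : Type} [Fintype ι]

theorem fourier_timeFreqShift_zero (ω : EuclideanSpace ℝ ι) (g : 𝓢(EuclideanSpace ℝ ι, ℂ)) :
    𝓕 (timeFreqShift 0 ω g) = compSubConstCLM ℂ ω (𝓕 g) := by
  ext ξ
  rw [compSubConstCLM_apply, fourier_coe, fourier_coe, Real.fourier_eq, Real.fourier_eq]
  refine integral_congr_ae (Filter.Eventually.of_forall fun t => ?_)
  simp only [timeFreqShift_apply, Circle.smul_def, Real.fourierChar_apply, smul_eq_mul, sub_zero,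
    ← mul_assoc, ← Complex.exp_add, inner_sub_right]
  congr 2
  push_cast
  ring

/-- Modulation is translation on the Fourier side, so the estimates for translations also serve for
modulations. -/
theorem timeFreqShift_eq_fourierInv (x ω : EuclideanSpace ℝ ι) (g : 𝓢(EuclideanSpace ℝ ι, ℂ)) :
    timeFreqShift x ω g =
      𝓕⁻ (compSubConstCLM ℂ ω (𝓕 (compSubConstCLM ℂ x g))) := by
  rw [← fourier_timeFreqShift_zero, FourierTransform.fourierInv_fourier_eq]
  ext t
  simp [timeFreqShift_apply]

theorem continuous_timeFreqShift_left (ω : EuclideanSpace ℝ ι) (g : 𝓢(EuclideanSpace ℝ ι, ℂ)) :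
    Continuous fun x => timeFreqShift x ω g :=
  (smulLeftCLM ℂ fun t : EuclideanSpace ℝ ι => (Real.fourierChar ⟪t, ω⟫ : ℂ)).continuous.comp
    (continuous_compSubConst g)

theorem continuous_timeFreqShift_right (x : EuclideanSpace ℝ ι) (g : 𝓢(EuclideanSpace ℝ ι, ℂ)) :
    Continuous fun ω => timeFreqShift x ω g := by
  simp_rw [timeFreqShift_eq_fourierInv]
  exact (FourierTransform.fourierInvCLM ℂ 𝓢(EuclideanSpace ℝ ι, ℂ)).continuous.comp
    (continuous_compSubConst _)

/-- A continuous function of a time-frequency shift is jointly measurable. -/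
theorem stronglyMeasurable_comp_timeFreqShift {B : Type*} [TopologicalSpace B]
    [TopologicalSpace.PseudoMetrizableSpace B] {J : 𝓢(EuclideanSpace ℝ ι, ℂ) → B}
    (hJ : Continuous J) (g : 𝓢(EuclideanSpace ℝ ι, ℂ)) :
    StronglyMeasurable fun w : EuclideanSpace ℝ ι × EuclideanSpace ℝ ι =>
      J (timeFreqShift w.1 w.2 g) :=
  -- Separate continuity in `x` and `ω` suffices for joint measurability.
  stronglyMeasurable_uncurry_of_continuous_of_stronglyMeasurable
    (u := fun x ω => J (timeFreqShift x ω g))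
    (fun ω => hJ.comp (continuous_timeFreqShift_left ω g))
    fun x => (hJ.comp (continuous_timeFreqShift_right x g)).stronglyMeasurable

/-- The translation bound is used twice, for `p ∘ 𝓕⁻` and then for the resulting seminorm composed
with `𝓕`. -/
theorem seminorm_timeFreqShift_le (p : Seminorm ℂ 𝓢(EuclideanSpace ℝ ι, ℂ)) (hp : Continuous p)
    (g : 𝓢(EuclideanSpace ℝ ι, ℂ)) :
    ∃ (K : ℕ) (C : ℝ), ∀ w : EuclideanSpace ℝ ι × EuclideanSpace ℝ ι,
      p (timeFreqShift w.1 w.2 g) ≤ C * (1 + ‖w‖) ^ K := by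
  obtain ⟨K₁, q₁, hq₁, h₁⟩ := seminorm_compSubConst_le
    (p.comp (FourierTransform.fourierInvCLM ℂ 𝓢(EuclideanSpace ℝ ι, ℂ)).toLinearMap)
    (hp.comp (FourierTransform.fourierInvCLM ℂ 𝓢(EuclideanSpace ℝ ι, ℂ)).continuous)
  obtain ⟨K₂, q₂, hq₂, h₂⟩ := seminorm_compSubConst_le
    (q₁.comp (FourierTransform.fourierCLM ℂ 𝓢(EuclideanSpace ℝ ι, ℂ)).toLinearMap)
    (hq₁.comp (FourierTransform.fourierCLM ℂ 𝓢(EuclideanSpace ℝ ι, ℂ)).continuous)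
  refine ⟨K₁ + K₂, q₂ g, fun w => ?_⟩
  rw [timeFreqShift_eq_fourierInv]
  refine (h₁ w.2 (𝓕 (compSubConstCLM ℂ w.1 g))).trans ?_
  have h3 := h₂ w.1 g
  have e1 : ‖w.1‖ ≤ ‖w‖ := norm_fst_le w
  have e2 : ‖w.2‖ ≤ ‖w‖ := norm_snd_le w
  have : 0 ≤ q₂ g := apply_nonneg _ _
  calc (1 + ‖w.2‖) ^ K₁ * q₁ (𝓕 (compSubConstCLM ℂ w.1 g))
      ≤ (1 + ‖w‖) ^ K₁ * ((1 + ‖w‖) ^ K₂ * q₂ g) := by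
        gcongr
        exact h3.trans (by gcongr)
    _ = _ := by rw [pow_add]; ring

end TimeFrequencyShift

/-! ### Exchanging tempered distributions with integrals of Schwartz functions. -/

section WeakIntegral

open LineDeriv

variable {V : Type} [NormedAddCommGroup V] [NormedSpace ℝ V]
  {Ω : Type} [MeasurableSpace Ω] {μ : Measure Ω}

/-- The evaluation of Schwartz functions at a point. -/
noncomputable def schwartzEval (x : V) : 𝓢(V, ℂ) →L[ℂ] ℂ :=
  (BoundedContinuousFunction.evalCLM ℂ x).comp (toBoundedContinuousFunctionCLM ℂ V ℂ)

theorem schwartzEval_apply (x : V) (f : 𝓢(V, ℂ)) : schwartzEval x f = f x := rfl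

/-- A functional that is controlled by the values of a bounded family of functionals commutes with
an integral as soon as the members of the family do. -/
theorem apply_eq_integral_of_family {X : Type} (e : X → 𝓢(V, ℂ) →L[ℂ] ℂ)
    (σ : 𝓢(V, ℂ) →L[ℂ] ℂ) (p : Seminorm ℂ 𝓢(V, ℂ)) (hp : Continuous p)
    (hep : ∀ ξ f, ‖e ξ f‖ ≤ p f) (C : ℝ)
    (hσ : ∀ f c, 0 ≤ c → (∀ ξ, ‖e ξ f‖ ≤ c) → ‖σ f‖ ≤ C * c) {G : Ω → 𝓢(V, ℂ)}
    (hG : ∀ (B : Type) [NormedAddCommGroup B] [NormedSpace ℂ B] [CompleteSpace B]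
      (J : 𝓢(V, ℂ) →L[ℂ] B), Integrable (fun w => J (G w)) μ)
    {H : 𝓢(V, ℂ)} (hH : ∀ ξ, e ξ H = ∫ w, e ξ (G w) ∂μ) : σ H = ∫ w, σ (G w) ∂μ := by
  -- With the discrete topology, the bounded continuous functions on `X` are the Banach space
  -- `ℓ^∞(X)`. The functional `σ` is factored through `J : f ↦ (e ξ f)_ξ`, and the Bochner integral
  -- is taken there.
  let _ : TopologicalSpace X := ⊥
  have : DiscreteTopology X := ⟨rfl⟩
  let J₀ : 𝓢(V, ℂ) →ₗ[ℂ] BoundedContinuousFunction X ℂ :=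
    { toFun := fun f => BoundedContinuousFunction.ofNormedAddCommGroupDiscrete
        (fun ξ => e ξ f) (p f) fun ξ => hep ξ f
      map_add' := fun f g => by ext ξ; exact map_add (e ξ) f g
      map_smul' := fun c f => by ext ξ; exact map_smul (e ξ) c f }
  have hJp : ∀ f, ‖J₀ f‖ ≤ p f := fun f =>
    (BoundedContinuousFunction.norm_le (apply_nonneg _ _)).2 fun ξ => hep ξ f
  have hJc : Continuous J₀ := by
    refine Seminorm.continuous_of_le (p := (normSeminorm ℂ _).comp J₀) hp hJp |> fun h => ?_
    refine continuous_of_continuousAt_zero J₀ ?_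
    rw [ContinuousAt, map_zero, tendsto_zero_iff_norm_tendsto_zero]
    exact h.tendsto' 0 0 (map_zero _)
  let J : 𝓢(V, ℂ) →L[ℂ] BoundedContinuousFunction X ℂ := ⟨J₀, hJc⟩
  have hJ : ∀ f, ‖σ f‖ ≤ C * ‖J f‖ := fun f =>
    hσ f _ (norm_nonneg _) fun ξ => (J f).norm_coe_le_norm ξ
  -- The linear section `r` need not be continuous: `‖σ f‖ ≤ C ‖J f‖` alone makes `σ ∘ r` bounded on
  -- the range of `J`, and Hahn–Banach extends it.
  obtain ⟨r, hr⟩ := J.toLinearMap.rangeRestrict.exists_rightInverse_of_surjective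
    (LinearMap.range_rangeRestrict _)
  have hr' : ∀ y, J (r y) = y := fun y => congrArg Subtype.val (LinearMap.congr_fun hr y)
  let φ : StrongDual ℂ (LinearMap.range J.toLinearMap) :=
    (σ.toLinearMap ∘ₗ r).mkContinuous C fun y => by
      refine (hJ (r y)).trans (le_of_eq ?_)
      rw [hr']
      rfl
  obtain ⟨L, hL, -⟩ := exists_extension_norm_eq _ φ
  have hLσ : ∀ f, σ f = L (J f) := by
    intro f
    set y : LinearMap.range J.toLinearMap := ⟨J f, f, rfl⟩
    have h1 : L (J f) = σ (r y) := hL y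
    -- `J` kills `f - r y`, hence so does `σ`, and the factorization does not depend on `r`.
    have h2 := hJ (f - r y)
    rw [map_sub, map_sub, hr', sub_self, norm_zero, mul_zero, norm_le_zero_iff,
      sub_eq_zero] at h2
    rw [h1, h2]
  simp_rw [hLσ]
  rw [L.integral_comp_comm (hG _ J)]
  congr 1
  ext ξ
  exact (hH ξ).trans
    ((BoundedContinuousFunction.evalCLM ℂ ξ).integral_comp_comm (hG _ J))

/-- Differentiation under the integral. The dominating function is the sup norm of `∂_v (G w)`,
integrable because `hG` covers maps into every Banach space, here the bounded continuous functions.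
-/
theorem lineDerivOp_eq_integral (v : V) {G : Ω → 𝓢(V, ℂ)}
    (hG : ∀ (B : Type) [NormedAddCommGroup B] [NormedSpace ℂ B] [CompleteSpace B]
      (J : 𝓢(V, ℂ) →L[ℂ] B), Integrable (fun w => J (G w)) μ)
    {H : 𝓢(V, ℂ)} (hH : ∀ x, H x = ∫ w, G w x ∂μ) (x : V) :
    (∂_{v} H) x = ∫ w, (∂_{v} (G w)) x ∂μ := by
  have hd : ∀ (f : 𝓢(V, ℂ)) (t : ℝ),
      HasDerivAt (fun s : ℝ => f (x + s • v)) ((∂_{v} f) (x + t • v)) t := by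
    intro f t
    rw [lineDerivOp_apply_eq_fderiv]
    have h1 : HasDerivAt (fun s : ℝ => x + s • v) v t := by
      simpa using ((hasDerivAt_id t).smul_const v).const_add x
    exact (f.hasFDerivAt (x + t • v)).comp_hasDerivAt t h1
  have h := (hasDerivAt_integral_of_dominated_loc_of_deriv_le (μ := μ) (𝕜 := ℝ) (x₀ := (0 : ℝ))
    (F := fun t w => G w (x + t • v)) (F' := fun t w => (∂_{v} (G w)) (x + t • v))
    (bound := fun w => ‖(toBoundedContinuousFunctionCLM ℂ V ℂ ∘L
      lineDerivOpCLM ℂ 𝓢(V, ℂ) v) (G w)‖) Filter.univ_mem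
    (Filter.Eventually.of_forall fun t => (hG ℂ (schwartzEval (x + t • v))).1)
    (hG ℂ (schwartzEval (x + (0 : ℝ) • v)))
    (hG ℂ (schwartzEval (x + (0 : ℝ) • v) ∘L lineDerivOpCLM ℂ 𝓢(V, ℂ) v)).1
    (Filter.Eventually.of_forall fun w t _ => BoundedContinuousFunction.norm_coe_le_norm
      (toBoundedContinuousFunctionCLM ℂ V ℂ (∂_{v} (G w))) (x + t • v)) (hG _ _).norm
    (Filter.Eventually.of_forall fun w t _ => hd (G w) t)).2
  simp_rw [← hH] at h
  simpa using (hd H 0).unique h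

theorem iteratedLineDerivOp_eq_integral {n : ℕ} (v : Fin n → V) {G : Ω → 𝓢(V, ℂ)}
    (hG : ∀ (B : Type) [NormedAddCommGroup B] [NormedSpace ℂ B] [CompleteSpace B]
      (J : 𝓢(V, ℂ) →L[ℂ] B), Integrable (fun w => J (G w)) μ)
    {H : 𝓢(V, ℂ)} (hH : ∀ x, H x = ∫ w, G w x ∂μ) (x : V) :
    (∂^{v} H) x = ∫ w, (∂^{v} (G w)) x ∂μ := by
  induction n generalizing x with
  | zero => simpa using hH x
  | succ n ih =>
    simp_rw [iteratedLineDerivOp_succ_left]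
    exact lineDerivOp_eq_integral (v 0) (G := fun w => ∂^{Fin.tail v} (G w))
      (fun B _ _ _ J => hG B (J ∘L iteratedLineDerivOpCLM ℂ 𝓢(V, ℂ) (Fin.tail v)))
      (ih (Fin.tail v)) x

theorem norm_iteratedFDeriv_le_of_forall_div_le (f : 𝓢(V, ℂ)) (k n : ℕ) {c : ℝ} (hc : 0 ≤ c)
    (x : V) (h : ∀ v : Fin n → V, ‖x‖ ^ k / (∏ i, ‖v i‖) * ‖(∂^{v} f) x‖ ≤ c) :
    ‖x‖ ^ k * ‖iteratedFDeriv ℝ n f x‖ ≤ c := by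
  rcases eq_or_lt_of_le (pow_nonneg (norm_nonneg x) k) with h0 | h0
  · rwa [← h0, zero_mul]
  rw [← le_div_iff₀' h0]
  refine ContinuousMultilinearMap.opNorm_le_bound (by positivity) fun v => ?_
  rcases eq_or_lt_of_le (Finset.prod_nonneg fun i (_ : i ∈ Finset.univ) => norm_nonneg (v i))
    with h1 | h1
  -- If a direction vanishes, the weight in `h` is `0` by division by zero, but then the multilinear
  -- derivative vanishes too.
  · obtain ⟨i, -, hi⟩ := Finset.prod_eq_zero_iff.1 h1.symm
    rw [ContinuousMultilinearMap.map_coord_zero _ i (norm_eq_zero.1 hi), norm_zero]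
    positivity
  · have h2 := h v
    rw [iteratedLineDerivOp_eq_iteratedFDeriv, div_mul_eq_mul_div, div_le_iff₀ h1] at h2
    rwa [div_mul_eq_mul_div, le_div_iff₀' h0]

/-- Tempered distributions commute with weak integrals of Schwartz functions. -/
theorem apply_eq_integral_of_forall_eq_integral (σ : 𝓢(V, ℂ) →L[ℂ] ℂ) {G : Ω → 𝓢(V, ℂ)}
    (hG : ∀ (B : Type) [NormedAddCommGroup B] [NormedSpace ℂ B] [CompleteSpace B]
      (J : 𝓢(V, ℂ) →L[ℂ] B), Integrable (fun w => J (G w)) μ)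
    {H : 𝓢(V, ℂ)} (hH : ∀ x, H x = ∫ w, G w x ∂μ) : σ H = ∫ w, σ (G w) ∂μ := by
  obtain ⟨C, m, hC⟩ := exists_seminorm_le_sup_Iic
    ((normSeminorm ℂ ℂ).comp σ.toLinearMap) (continuous_norm.comp σ.continuous)
  -- Normalized directional derivatives at points, with weights: bounding all of them bounds every
  -- Schwartz seminorm of index at most `m`, and these control `σ`.
  let e : (Σ i : Finset.Iic m, V × (Fin i.1.2 → V)) → 𝓢(V, ℂ) →L[ℂ] ℂ := fun ξ =>
    ((‖ξ.2.1‖ ^ ξ.1.1.1 / ∏ i, ‖ξ.2.2 i‖ : ℝ) : ℂ) •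
      (schwartzEval ξ.2.1 ∘L iteratedLineDerivOpCLM ℂ 𝓢(V, ℂ) ξ.2.2)
  have he : ∀ ξ f, ‖e ξ f‖ =
      ‖ξ.2.1‖ ^ ξ.1.1.1 / (∏ i, ‖ξ.2.2 i‖) * ‖(∂^{ξ.2.2} f) ξ.2.1‖ := by
    intro ξ f
    change ‖((‖ξ.2.1‖ ^ ξ.1.1.1 / ∏ i, ‖ξ.2.2 i‖ : ℝ) : ℂ) * (∂^{ξ.2.2} f) ξ.2.1‖ = _
    rw [norm_mul, Complex.norm_of_nonneg (by positivity)]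
  refine apply_eq_integral_of_family e σ
    ((Finset.Iic m).sup fun m => SchwartzMap.seminorm ℂ m.1 m.2)
    (continuous_finset_sup_seminorm _) (fun ξ f => ?_) C (fun f c hc h => ?_) hG fun ξ => ?_
  · rw [he]
    refine le_trans ?_ (Finset.le_sup (f := fun m : ℕ × ℕ =>
      (SchwartzMap.seminorm ℂ m.1 m.2 : Seminorm ℂ 𝓢(V, ℂ))) ξ.1.2 f)
    refine le_trans ?_ (f.le_seminorm ℂ ξ.1.1.1 ξ.1.1.2 ξ.2.1)
    rw [iteratedLineDerivOp_eq_iteratedFDeriv, div_mul_eq_mul_div]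
    refine div_le_of_le_mul₀ (by positivity) (by positivity) ?_
    rw [mul_assoc]
    gcongr
    exact ContinuousMultilinearMap.le_opNorm _ _
  · refine (hC f).trans ?_
    change (C : ℝ) * _ ≤ _
    gcongr
    refine Seminorm.finset_sup_apply_le hc fun i hi => ?_
    refine SchwartzMap.seminorm_le_bound ℂ _ _ _ hc fun x => ?_
    refine norm_iteratedFDeriv_le_of_forall_div_le f i.1 i.2 hc x fun v => ?_
    have := h ⟨⟨i, hi⟩, x, v⟩
    rwa [he] at this
  · change _ * (∂^{ξ.2.2} H) ξ.2.1 = ∫ w, _ * (∂^{ξ.2.2} (G w)) ξ.2.1 ∂μ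
    rw [integral_const_mul, iteratedLineDerivOp_eq_integral ξ.2.2 hG hH]

end WeakIntegral

/-! ### Inversion of the short-time Fourier transform. -/

section Inversion

variable {ι : Type} [Fintype ι]

theorem schwartzConj_timeFreqShift (x ω : EuclideanSpace ℝ ι) (g : 𝓢(EuclideanSpace ℝ ι, ℂ)) :
    schwartzConj (timeFreqShift x ω g) = timeFreqShift x (-ω) (schwartzConj g) := by
  ext t
  simp only [schwartzConj_apply, timeFreqShift_apply, map_mul, ← Complex.exp_conj,
    Complex.conj_I, Complex.conj_ofReal, inner_neg_right, map_ofNat]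
  congr 2
  push_cast
  ring

/-- The linear equivalence `(z, t) ↦ (t - z, t)`. -/
noncomputable def subSndEquiv (V : Type) [NormedAddCommGroup V] [NormedSpace ℝ V]
    [FiniteDimensional ℝ V] : (V × V) ≃L[ℝ] V × V :=
  LinearEquiv.toContinuousLinearEquiv
    { toFun := fun p => (p.2 - p.1, p.2)
      invFun := fun p => (p.2 - p.1, p.2)
      map_add' := fun p q => by ext <;> simp [sub_add_sub_comm]
      map_smul' := fun c p => by ext <;> simp [smul_sub]
      left_inv := fun p => by simp
      right_inv := fun p => by simp }

/-- The short-time Fourier transform of a Schwartz function, as a Schwartz function. -/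
noncomputable def schwartzSTFT (γ F : 𝓢(EuclideanSpace ℝ ι, ℂ)) :
    𝓢(EuclideanSpace ℝ ι × EuclideanSpace ℝ ι, ℂ) :=
  schwartzPartialFourier <| compCLMOfContinuousLinearEquiv ℂ (subSndEquiv _) <|
    schwartzTensor (schwartzConj γ) F

theorem schwartzSTFT_eq_fourier (γ F : 𝓢(EuclideanSpace ℝ ι, ℂ)) (z ζ : EuclideanSpace ℝ ι) :
    schwartzSTFT γ F (z, ζ) = 𝓕 (schwartzSection (compCLMOfContinuousLinearEquiv ℂ
      (subSndEquiv _) (schwartzTensor (schwartzConj γ) F)) z) ζ :=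
  partialFourier_eq _ _

theorem conj_schwartzSTFT (γ F : 𝓢(EuclideanSpace ℝ ι, ℂ))
    (w : EuclideanSpace ℝ ι × EuclideanSpace ℝ ι) :
    conj (schwartzSTFT γ F w) = ∫ t, timeFreqShift w.1 w.2 γ t * conj (F t) := by
  change conj (∫ y : EuclideanSpace ℝ ι, Real.fourierChar (-⟪y, w.2⟫) •
    (schwartzConj γ (y - w.1) * F y)) = _
  rw [← integral_conj]
  refine integral_congr_ae (Filter.Eventually.of_forall fun t => ?_)
  simp only [schwartzConj_apply, timeFreqShift_apply, map_mul, ← Complex.exp_conj,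
    Circle.smul_def, smul_eq_mul, Real.fourierChar_apply, Complex.conj_I, Complex.conj_ofReal,
    Complex.conj_conj, ← mul_assoc]
  congr 3
  push_cast
  ring

/-- The transform of a Schwartz function decays rapidly, while `J` of a time-frequency shift grows
at most polynomially. A general target `B` is what the exchange of `σ` with the integral requires.
-/
theorem integrable_schwartzSTFT_mul (γ F Φ : 𝓢(EuclideanSpace ℝ ι, ℂ)) {B : Type}
    [NormedAddCommGroup B] [NormedSpace ℂ B] (J : 𝓢(EuclideanSpace ℝ ι, ℂ) →L[ℂ] B) :
    Integrable fun w : EuclideanSpace ℝ ι × EuclideanSpace ℝ ι =>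
      schwartzSTFT γ F w • J (timeFreqShift w.1 w.2 Φ) := by
  have : (volume : Measure (EuclideanSpace ℝ ι × EuclideanSpace ℝ ι)).IsAddHaarMeasure :=
    Measure.prod.instIsAddHaarMeasure volume volume
  obtain ⟨K, C, hC⟩ := seminorm_timeFreqShift_le ((normSeminorm ℂ B).comp J.toLinearMap)
    (continuous_norm.comp J.continuous) Φ
  have hm : AEStronglyMeasurable (fun w : EuclideanSpace ℝ ι × EuclideanSpace ℝ ι =>
      schwartzSTFT γ F w • J (timeFreqShift w.1 w.2 Φ)) :=
    (schwartzSTFT γ F).continuous.aestronglyMeasurable.smul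
      (stronglyMeasurable_comp_timeFreqShift J.continuous Φ).aestronglyMeasurable
  refine Integrable.mono' (g := fun w => |C| * (2 ^ (K - 1) *
    (‖schwartzSTFT γ F w‖ + ‖w‖ ^ K * ‖schwartzSTFT γ F w‖))) ?_ hm
    (Filter.Eventually.of_forall fun w => ?_)
  · exact (((schwartzSTFT γ F).integrable.norm.add
      ((schwartzSTFT γ F).integrable_pow_mul volume K)).const_mul _).const_mul _
  · rw [norm_smul]
    have h1 : ‖J (timeFreqShift w.1 w.2 Φ)‖ ≤ C * (1 + ‖w‖) ^ K := hC w
    have h2 := add_pow_le zero_le_one (norm_nonneg w) K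
    rw [one_pow] at h2
    calc ‖schwartzSTFT γ F w‖ * ‖J (timeFreqShift w.1 w.2 Φ)‖
        ≤ ‖schwartzSTFT γ F w‖ * (|C| * (2 ^ (K - 1) * (1 + ‖w‖ ^ K))) := by
          gcongr
          exact h1.trans (mul_le_mul (le_abs_self C) h2 (by positivity) (abs_nonneg C))
      _ = _ := by ring

/-- The inversion formula of the short-time Fourier transform for Schwartz functions. -/
theorem integral_schwartzSTFT_mul (γ F Φ : 𝓢(EuclideanSpace ℝ ι, ℂ)) (x : EuclideanSpace ℝ ι) :
    ∫ w : EuclideanSpace ℝ ι × EuclideanSpace ℝ ι,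
        schwartzSTFT γ F w * timeFreqShift w.1 w.2 Φ x =
      (∫ t, Φ t * conj (γ t)) * F x := by
  have hi := integrable_schwartzSTFT_mul γ F Φ (schwartzEval x)
  simp_rw [schwartzEval_apply, smul_eq_mul] at hi
  -- For fixed `z` the integral over `ζ` is a Fourier inversion at `x`; the remaining integral over
  -- `z` becomes `∫ Φ conj γ` by the substitution `t = x - z`.
  rw [Measure.volume_eq_prod, integral_prod _ hi, ← integral_mul_const,
    ← integral_sub_left_eq_self (fun t => Φ t * conj (γ t) * F x) volume x]
  refine integral_congr_ae (Filter.Eventually.of_forall fun z => ?_)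
  set K := compCLMOfContinuousLinearEquiv ℂ
      (subSndEquiv _) (schwartzTensor (schwartzConj γ) F)
  have hK : ∀ ζ, schwartzSTFT γ F (z, ζ) = 𝓕 (schwartzSection K z) ζ :=
    schwartzSTFT_eq_fourier γ F z
  have h : (𝓕⁻ (𝓕 (schwartzSection K z))) x = conj (γ (x - z)) * F x := by
    rw [FourierTransform.fourierInv_fourier_eq]
    change schwartzConj γ (x - z) * F x = _
    rw [schwartzConj_apply]
  change ∫ ζ, schwartzSTFT γ F (z, ζ) * timeFreqShift z ζ Φ x =
    Φ (x - z) * conj (γ (x - z)) * F x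
  rw [mul_assoc, ← h, fourierInv_coe, Real.fourierInv_eq, ← integral_const_mul]
  refine integral_congr_ae (Filter.Eventually.of_forall fun ζ => ?_)
  simp only [hK, timeFreqShift_apply, Circle.smul_def, smul_eq_mul,
    Real.fourierChar_apply, real_inner_comm x ζ]
  push_cast
  ring_nf

/-- The inversion formula of the short-time Fourier transform for tempered distributions. -/
theorem integral_stft_mul (σ : 𝓢'(EuclideanSpace ℝ ι, ℂ)) (γ F Φ : 𝓢(EuclideanSpace ℝ ι, ℂ)) :
    ∫ w : EuclideanSpace ℝ ι × EuclideanSpace ℝ ι,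
        stft Φ σ w.1 w.2 * conj (schwartzSTFT γ F w) =
      conj (∫ t, Φ t * conj (γ t)) * sesqPairing σ F := by
  let G : EuclideanSpace ℝ ι × EuclideanSpace ℝ ι → 𝓢(EuclideanSpace ℝ ι, ℂ) := fun w =>
    conj (schwartzSTFT γ F w) • schwartzConj (timeFreqShift w.1 w.2 Φ)
  have hG : ∀ (B : Type) [NormedAddCommGroup B] [NormedSpace ℂ B] [CompleteSpace B]
      (J : 𝓢(EuclideanSpace ℝ ι, ℂ) →L[ℂ] B), Integrable (fun w => J (G w)) := by
    intro B _ _ _ J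
    -- Conjugation reflects the frequency and conjugates the windows, so integrability is
    -- transported by the measure-preserving map `(z, ζ) ↦ (z, -ζ)`.
    have hs : ∀ w : EuclideanSpace ℝ ι × EuclideanSpace ℝ ι, J (G w) =
        schwartzSTFT (schwartzConj γ) (schwartzConj F) (w.1, -w.2) •
          J (timeFreqShift w.1 (-w.2) (schwartzConj Φ)) := by
      intro w
      rw [map_smul, schwartzConj_timeFreqShift]
      congr 1
      rw [← Complex.conj_conj (schwartzSTFT (schwartzConj γ) _ _), conj_schwartzSTFT,
        conj_schwartzSTFT, ← integral_conj]
      refine integral_congr_ae (Filter.Eventually.of_forall fun t => ?_)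
      simp only [map_mul, Complex.conj_conj, ← schwartzConj_timeFreqShift, schwartzConj_apply]
    have h := integrable_schwartzSTFT_mul (schwartzConj γ) (schwartzConj F) (schwartzConj Φ) J
    have hp : MeasurePreserving (fun w : EuclideanSpace ℝ ι × EuclideanSpace ℝ ι => (w.1, -w.2)) :=
      (MeasurePreserving.id volume).prod (Measure.measurePreserving_neg volume)
    simp_rw [hs]
    exact hp.integrable_comp_of_integrable h
  have hH : ∀ x, (conj (∫ t, Φ t * conj (γ t)) • schwartzConj F) x = ∫ w, G w x := by
    intro x
    change conj (∫ t, Φ t * conj (γ t)) * schwartzConj F x =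
      ∫ w, conj (schwartzSTFT γ F w) * schwartzConj (timeFreqShift w.1 w.2 Φ) x
    rw [schwartzConj_apply, ← map_mul, ← integral_schwartzSTFT_mul, ← integral_conj]
    simp only [schwartzConj_apply, map_mul]
  have h := apply_eq_integral_of_forall_eq_integral (σ : 𝓢(EuclideanSpace ℝ ι, ℂ) →L[ℂ] ℂ) hG hH
  change (σ : 𝓢(EuclideanSpace ℝ ι, ℂ) →L[ℂ] ℂ) _ = _ at h
  rw [map_smul] at h
  refine Eq.trans ?_ h.symm
  refine integral_congr_ae (Filter.Eventually.of_forall fun w => ?_)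
  change _ = (σ : 𝓢(EuclideanSpace ℝ ι, ℂ) →L[ℂ] ℂ) (_ • _)
  rw [map_smul, smul_eq_mul, mul_comm]
  rfl

end Inversion

/-! ### Moyal's identity and the choice of the dual window. -/

section Moyal

variable {V : Type} [NormedAddCommGroup V] [InnerProductSpace ℝ V] [FiniteDimensional ℝ V]
  [MeasurableSpace V] [BorelSpace V]

theorem SchwartzMap.integrable_mul_conj {W : Type} [NormedAddCommGroup W] [NormedSpace ℝ W]
    [MeasurableSpace W] [BorelSpace W] [SecondCountableTopology W] {μ : Measure W}
    [μ.HasTemperateGrowth] (P Q : 𝓢(W, ℂ)) : Integrable (fun z => P z * conj (Q z)) μ :=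
  P.integrable.mul_bdd (c := SchwartzMap.seminorm ℂ 0 0 Q)
    (Complex.continuous_conj.comp Q.continuous).aestronglyMeasurable
    (Filter.Eventually.of_forall fun z => by
      rw [RCLike.norm_conj]
      exact Q.norm_le_seminorm ℂ z)

instance isAddHaarMeasure_volume_prod : (volume : Measure (V × V)).IsAddHaarMeasure :=
  Measure.prod.instIsAddHaarMeasure volume volume

/-- Plancherel's theorem for the partial Fourier transform. -/
theorem integral_schwartzPartialFourier_mul_conj (P Q : 𝓢(V × V, ℂ)) :
    ∫ z, schwartzPartialFourier P z * conj (schwartzPartialFourier Q z) =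
      ∫ z, P z * conj (Q z) := by
  have h1 := (schwartzPartialFourier P).integrable_mul_conj (μ := volume)
    (schwartzPartialFourier Q)
  have h2 := P.integrable_mul_conj (μ := volume) Q
  rw [Measure.volume_eq_prod] at h1 h2 ⊢
  rw [integral_prod _ h1, integral_prod _ h2]
  refine integral_congr_ae (Filter.Eventually.of_forall fun x => ?_)
  have h := integral_inner_fourier_fourier (schwartzSection Q x) (schwartzSection P x)
  simp only [RCLike.inner_apply] at h
  refine Eq.trans ?_ h
  refine integral_congr_ae (Filter.Eventually.of_forall fun ω => ?_)
  change partialFourier P (x, ω) * conj (partialFourier Q (x, ω)) = _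
  rw [partialFourier_eq, partialFourier_eq]

/-- The preimage is the inverse partial transform, obtained by reflecting the second variable.
Surjectivity lets any window `Φ` be pulled back through `wignerMap`. -/
theorem schwartzPartialFourier_surjective :
    Function.Surjective (schwartzPartialFourier : 𝓢(V × V, ℂ) → 𝓢(V × V, ℂ)) := by
  intro φ
  refine ⟨compCLMOfContinuousLinearEquiv ℂ
    ((ContinuousLinearEquiv.refl ℝ V).prodCongr (ContinuousLinearEquiv.neg ℝ))
    (schwartzPartialFourier φ), ?_⟩
  ext ⟨x, ω⟩
  have h : (𝓕⁻ (𝓕 (schwartzSection φ x))) ω = φ (x, ω) := by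
    rw [FourierTransform.fourierInv_fourier_eq, schwartzSection_apply]
  rw [← h, fourierInv_coe, Real.fourierInv_eq, ← integral_neg_eq_self]
  change ∫ y : V, Real.fourierChar (-⟪y, ω⟫) • partialFourier φ (x, -y) = _
  refine integral_congr_ae (Filter.Eventually.of_forall fun y => ?_)
  simp only [partialFourier_eq, inner_neg_left]

/-- The push-forward of a Haar measure is Haar, hence proportional to `ν`. The factor is left
uncomputed, since the final constant may depend on `A`. -/
theorem exists_integral_comp_continuousLinearEquiv {W W' : Type}
    [NormedAddCommGroup W] [NormedSpace ℝ W] [FiniteDimensional ℝ W] [MeasurableSpace W]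
    [BorelSpace W] [NormedAddCommGroup W'] [NormedSpace ℝ W'] [FiniteDimensional ℝ W']
    [MeasurableSpace W'] [BorelSpace W'] (μ : Measure W) [μ.IsAddHaarMeasure] (ν : Measure W')
    [ν.IsAddHaarMeasure] (L : W ≃L[ℝ] W') :
    ∃ κ : ℝ, 0 < κ ∧ ∀ h : W' → ℂ, ∫ x, h (L x) ∂μ = κ * ∫ y, h y ∂ν := by
  have : (μ.map L).IsAddHaarMeasure := L.isAddHaarMeasure_map μ
  refine ⟨(Measure.addHaarScalarFactor (μ.map L) ν : ℝ), ?_, fun h => ?_⟩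
  · exact_mod_cast Measure.addHaarScalarFactor_pos_of_isAddHaarMeasure _ _
  · refine (L.toHomeomorph.measurableEmbedding.integral_map h).symm.trans ?_
    change ∫ y, h y ∂(μ.map L) = _
    conv_lhs => rw [Measure.isAddLeftInvariant_eq_smul (μ.map L) ν]
    rw [integral_smul_nnreal_measure]
    rfl

/-- Some product of bump functions is not orthogonal to a given non-zero Schwartz function. -/
theorem exists_schwartzTensor_integral_ne_zero {R : 𝓢(V × V, ℂ)} (hR : R ≠ 0) :
    ∃ f g : 𝓢(V, ℂ), ∫ z, schwartzTensor f (schwartzConj g) z * conj (R z) ≠ 0 := by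
  obtain ⟨⟨x₀, y₀⟩, hs⟩ : ∃ s, R s ≠ 0 := by
    by_contra! h
    exact hR (SchwartzMap.ext h)
  set c := R (x₀, y₀)
  -- Rotating by `c` makes the real part positive near `(x₀, y₀)`. Multiplied by bumps supported
  -- there it is continuous, non-negative and positive at the centre, so its integral is positive.
  set h : V × V → ℝ := fun z => (c * conj (R z)).re
  have hc : Continuous h :=
    Complex.continuous_re.comp (continuous_const.mul (Complex.continuous_conj.comp R.continuous))
  have h0 : 0 < h (x₀, y₀) := by
    change 0 < (c * conj c).re
    rw [Complex.mul_conj, Complex.ofReal_re]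
    exact Complex.normSq_pos.2 hs
  obtain ⟨r, hr, hball⟩ := Metric.mem_nhds_iff.1
    (hc.continuousAt.preimage_mem_nhds (lt_mem_nhds h0))
  let b : ∀ x : V, ContDiffBump x := fun x => ⟨r / 2, r, by positivity, by linarith⟩
  have hb : ∀ x, HasCompactSupport fun t => ((b x t : ℝ) : ℂ) := fun x =>
    (b x).hasCompactSupport.comp_left (g := fun t : ℝ => (t : ℂ)) Complex.ofReal_zero
  have hbc : ∀ x, ContDiff ℝ (⊤ : ℕ∞) fun t => ((b x t : ℝ) : ℂ) := fun x =>
    Complex.ofRealCLM.contDiff.comp (b x).contDiff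
  let f : V → 𝓢(V, ℂ) := fun x => (hb x).toSchwartzMap (hbc x)
  refine ⟨f x₀, f y₀, fun hz => ?_⟩
  set ψ : V × V → ℝ := fun z => b x₀ z.1 * b y₀ z.2 * h z with hψ
  have hval : ∀ z, ψ z = RCLike.re (c * (schwartzTensor (f x₀) (schwartzConj (f y₀)) z *
      conj (R z))) := by
    intro z
    change _ = (c * ((b x₀ z.1 : ℂ) * schwartzConj (f y₀) z.2 * conj (R z))).re
    rw [schwartzConj_apply]
    change _ = (c * ((b x₀ z.1 : ℂ) * conj ((b y₀ z.2 : ℝ) : ℂ) * conj (R z))).re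
    rw [Complex.conj_ofReal, mul_left_comm, ← Complex.ofReal_mul, Complex.re_ofReal_mul]
  have hi := ((schwartzTensor (f x₀) (schwartzConj (f y₀))).integrable_mul_conj
    (μ := volume) R).const_mul c
  have hψ0 : ∫ z, ψ z = 0 := by
    simp_rw [hval]
    rw [integral_re hi, integral_const_mul, hz, mul_zero, map_zero]
  have hnn : 0 ≤ ψ := by
    intro z
    by_cases hz1 : z ∈ Metric.ball (x₀, y₀) r
    · exact mul_nonneg (mul_nonneg (b x₀).nonneg (b y₀).nonneg) (le_of_lt (hball hz1))
    -- In the max metric, leaving the ball means leaving the support of one of the two bumps.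
    · rw [Metric.mem_ball, not_lt, Prod.dist_eq, le_max_iff] at hz1
      rcases hz1 with h1 | h1
      · simp [hψ, (b x₀).zero_of_le_dist h1]
      · simp [hψ, (b y₀).zero_of_le_dist h1]
  have hψc : Continuous ψ := by
    have h1 : Continuous fun z : V × V => b x₀ z.1 := (b x₀).continuous.comp continuous_fst
    have h2 : Continuous fun z : V × V => b y₀ z.2 := (b y₀).continuous.comp continuous_snd
    exact (h1.mul h2).mul hc
  have hpos : 0 < ∫ z, ψ z := by
    rw [integral_pos_iff_support_of_nonneg hnn
      (hi.re.congr (Filter.Eventually.of_forall fun z => (hval z).symm))]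
    refine hψc.isOpen_support.measure_pos volume ⟨(x₀, y₀), ?_⟩
    have e1 : b x₀ x₀ = 1 := (b x₀).one_of_mem_closedBall (by simp [(b x₀).rIn_pos.le])
    have e2 : b y₀ y₀ = 1 := (b y₀).one_of_mem_closedBall (by simp [(b y₀).rIn_pos.le])
    simp [hψ, e1, e2, h0.ne']
  exact hpos.ne' hψ0

variable {d : ℕ}

/-- The map `R ↦ F₂ (R ∘ A)`, whose value at `f ⊗ conj g` is `B_A(f, g)`. -/
noncomputable def wignerMap (A : GL (Fin d ⊕ Fin d) ℝ)
    (R : 𝓢(EuclideanSpace ℝ (Fin d) × EuclideanSpace ℝ (Fin d), ℂ)) :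
    𝓢(EuclideanSpace ℝ (Fin d ⊕ Fin d), ℂ) :=
  compCLMOfContinuousLinearEquiv ℂ (splitEquiv d) <| schwartzPartialFourier <|
    compCLMOfContinuousLinearEquiv ℂ (blockEquiv A) R

theorem matrixWigner_eq_wignerMap (A : GL (Fin d ⊕ Fin d) ℝ)
    (f g : 𝓢(EuclideanSpace ℝ (Fin d), ℂ)) :
    matrixWigner A f g = wignerMap A (schwartzTensor f (schwartzConj g)) := rfl

theorem compCLMOfContinuousLinearEquiv_surjective {W W' : Type} [NormedAddCommGroup W]
    [NormedSpace ℝ W] [NormedAddCommGroup W'] [NormedSpace ℝ W'] (L : W ≃L[ℝ] W') :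
    Function.Surjective (compCLMOfContinuousLinearEquiv ℂ L : 𝓢(W', ℂ) → 𝓢(W, ℂ)) := fun f =>
  ⟨compCLMOfContinuousLinearEquiv ℂ L.symm f, by ext x; simp⟩

theorem wignerMap_surjective (A : GL (Fin d ⊕ Fin d) ℝ) : Function.Surjective (wignerMap A) :=
  ((compCLMOfContinuousLinearEquiv_surjective _).comp schwartzPartialFourier_surjective).comp
    (compCLMOfContinuousLinearEquiv_surjective _)

theorem exists_integral_wignerMap_mul_conj (A : GL (Fin d ⊕ Fin d) ℝ) :
    ∃ κ : ℝ, 0 < κ ∧ ∀ P Q, ∫ t, wignerMap A P t * conj (wignerMap A Q t) =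
      κ * ∫ z, P z * conj (Q z) := by
  obtain ⟨κ₁, h₁, e₁⟩ := exists_integral_comp_continuousLinearEquiv
    (volume : Measure (EuclideanSpace ℝ (Fin d ⊕ Fin d)))
    (volume : Measure (EuclideanSpace ℝ (Fin d) × EuclideanSpace ℝ (Fin d))) (splitEquiv d)
  obtain ⟨κ₂, h₂, e₂⟩ := exists_integral_comp_continuousLinearEquiv
    (volume : Measure (EuclideanSpace ℝ (Fin d) × EuclideanSpace ℝ (Fin d)))
    (volume : Measure (EuclideanSpace ℝ (Fin d) × EuclideanSpace ℝ (Fin d))) (blockEquiv A)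
  refine ⟨κ₁ * κ₂, mul_pos h₁ h₂, fun P Q => ?_⟩
  have h3 := e₂ fun z => P z * conj (Q z)
  have h4 := integral_schwartzPartialFourier_mul_conj
    (compCLMOfContinuousLinearEquiv ℂ (blockEquiv A) P)
    (compCLMOfContinuousLinearEquiv ℂ (blockEquiv A) Q)
  refine (e₁ fun z => schwartzPartialFourier (compCLMOfContinuousLinearEquiv ℂ (blockEquiv A) P) z *
    conj (schwartzPartialFourier (compCLMOfContinuousLinearEquiv ℂ (blockEquiv A) Q) z)).trans ?_
  rw [h4, Complex.ofReal_mul, mul_assoc, ← h3]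
  rfl

/-- Moyal's identity. -/
theorem exists_integral_matrixWigner_mul_conj (A : GL (Fin d ⊕ Fin d) ℝ) :
    ∃ κ : ℝ, 0 < κ ∧ ∀ f₁ g₁ f₂ g₂ : 𝓢(EuclideanSpace ℝ (Fin d), ℂ),
      ∫ t, matrixWigner A f₁ g₁ t * conj (matrixWigner A f₂ g₂ t) =
        κ * (inner ℂ (f₂.toLp 2 volume) (f₁.toLp 2 volume) *
          inner ℂ (g₁.toLp 2 volume) (g₂.toLp 2 volume)) := by
  obtain ⟨κ, hκ, h⟩ := exists_integral_wignerMap_mul_conj A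
  refine ⟨κ, hκ, fun f₁ g₁ f₂ g₂ => ?_⟩
  simp_rw [matrixWigner_eq_wignerMap]
  have hin : ∀ f g : 𝓢(EuclideanSpace ℝ (Fin d), ℂ), inner ℂ (f.toLp 2 volume) (g.toLp 2 volume) =
      ∫ x, inner ℂ (f x) (g x) := fun f g => inner_toL2_toL2_eq f g
  rw [h, hin, hin, ← integral_prod_mul, ← Measure.volume_eq_prod]
  congr 1
  refine integral_congr_ae (Filter.Eventually.of_forall fun z => ?_)
  change f₁ z.1 * schwartzConj g₁ z.2 * conj (f₂ z.1 * schwartzConj g₂ z.2) = _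
  simp only [schwartzConj_apply, map_mul, Complex.conj_conj, RCLike.inner_apply]
  ring

/-- Writing `Φ` as `wignerMap A R` reduces the claim to finding a product not orthogonal to `R`. The
result provides the dual window `B_A(f, g)`. -/
theorem exists_integral_mul_conj_matrixWigner_ne_zero (A : GL (Fin d ⊕ Fin d) ℝ)
    {Φ : 𝓢(EuclideanSpace ℝ (Fin d ⊕ Fin d), ℂ)} (hΦ : Φ ≠ 0) :
    ∃ f g : 𝓢(EuclideanSpace ℝ (Fin d), ℂ), ∫ t, Φ t * conj (matrixWigner A f g t) ≠ 0 := by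
  obtain ⟨κ, hκ, h⟩ := exists_integral_wignerMap_mul_conj A
  obtain ⟨R, rfl⟩ := wignerMap_surjective A Φ
  have hR : R ≠ 0 := by
    rintro rfl
    refine hΦ (SchwartzMap.ext fun t => ?_)
    change ∫ y : EuclideanSpace ℝ (Fin d), _ • (0 : ℂ) = 0
    simp
  obtain ⟨f, g, hfg⟩ := exists_schwartzTensor_integral_ne_zero hR
  refine ⟨f, g, ?_⟩
  rw [matrixWigner_eq_wignerMap, h]
  refine mul_ne_zero (by exact_mod_cast hκ.ne') fun h0 => hfg ?_
  rw [← map_zero (starRingEnd ℂ), ← h0, ← integral_conj]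
  simp [mul_comm]

end Moyal

/-! ### Covariance of `B_A` and the operator as an integral of rank-one operators. -/

section Quantization

variable {ι : Type} [Fintype ι]

theorem norm_toLp_timeFreqShift (x ω : EuclideanSpace ℝ ι) (g : 𝓢(EuclideanSpace ℝ ι, ℂ)) :
    ‖(timeFreqShift x ω g).toLp 2 volume‖ = ‖g.toLp 2 volume‖ := by
  have hin : ∀ f : 𝓢(EuclideanSpace ℝ ι, ℂ), inner ℂ (f.toLp 2 volume) (f.toLp 2 volume) =
      ∫ x, inner ℂ (f x) (f x) := fun f => inner_toL2_toL2_eq f f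
  have h : inner ℂ ((timeFreqShift x ω g).toLp 2 volume) ((timeFreqShift x ω g).toLp 2 volume) =
      inner ℂ (g.toLp 2 volume) (g.toLp 2 volume) := by
    rw [hin, hin, ← integral_sub_right_eq_self (fun t => inner ℂ (g t) (g t)) x]
    refine integral_congr_ae (Filter.Eventually.of_forall fun t => ?_)
    have e : ‖timeFreqShift x ω g t‖ = ‖g (t - x)‖ := by
      have h1 : (2 * Real.pi * Complex.I * ⟪t, ω⟫ : ℂ) =
          ((2 * Real.pi * ⟪t, ω⟫ : ℝ) : ℂ) * Complex.I := by
        push_cast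
        ring
      rw [timeFreqShift_apply, norm_mul, h1, Complex.norm_exp_ofReal_mul_I, one_mul]
    simp only [inner_self_eq_norm_sq_to_K, e]
  rw [inner_self_eq_norm_sq_to_K, inner_self_eq_norm_sq_to_K] at h
  have h' : ‖(timeFreqShift x ω g).toLp 2 volume‖ ^ 2 = ‖g.toLp 2 volume‖ ^ 2 := by
    exact_mod_cast h
  exact (sq_eq_sq₀ (norm_nonneg _) (norm_nonneg _)).1 h'

theorem stronglyMeasurable_stft (Φ : 𝓢(EuclideanSpace ℝ ι, ℂ)) (σ : 𝓢'(EuclideanSpace ℝ ι, ℂ)) :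
    StronglyMeasurable fun w : EuclideanSpace ℝ ι × EuclideanSpace ℝ ι => stft Φ σ w.1 w.2 := by
  have hc : Continuous (sesqPairing σ) :=
    (σ : 𝓢(EuclideanSpace ℝ ι, ℂ) →L[ℂ] ℂ).continuous.comp
      (postcompCLM (𝕜 := ℝ) (Complex.conjCLE : ℂ →L[ℝ] ℂ)).continuous
  exact stronglyMeasurable_comp_timeFreqShift hc Φ

variable {d : ℕ}

theorem inner_eq_inner_splitEquiv (s t : EuclideanSpace ℝ (Fin d ⊕ Fin d)) :
    ⟪s, t⟫ = ⟪(splitEquiv d s).1, (splitEquiv d t).1⟫ + ⟪(splitEquiv d s).2, (splitEquiv d t).2⟫ := by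
  simp only [PiLp.inner_apply, Fintype.sum_sum_type]
  rfl

/-- The translation part of the action of a time-frequency shift on the arguments of `B_A`. -/
noncomputable def wignerTranslation (A : GL (Fin d ⊕ Fin d) ℝ)
    (w : EuclideanSpace ℝ (Fin d ⊕ Fin d) × EuclideanSpace ℝ (Fin d ⊕ Fin d)) :
    EuclideanSpace ℝ (Fin d) × EuclideanSpace ℝ (Fin d) :=
  blockEquiv A ((splitEquiv d w.1).1, -(splitEquiv d w.2).2)

/-- The modulation part of the action of a time-frequency shift on the arguments of `B_A`. -/
noncomputable def wignerModulation (A : GL (Fin d ⊕ Fin d) ℝ)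
    (w : EuclideanSpace ℝ (Fin d ⊕ Fin d) × EuclideanSpace ℝ (Fin d ⊕ Fin d)) :
    EuclideanSpace ℝ (Fin d) × EuclideanSpace ℝ (Fin d) :=
  splitEquiv d (ContinuousLinearMap.adjoint
    (((splitEquiv d).trans ((blockEquiv A).symm.trans (splitEquiv d).symm)) :
      EuclideanSpace ℝ (Fin d ⊕ Fin d) →L[ℝ] EuclideanSpace ℝ (Fin d ⊕ Fin d))
    ((splitEquiv d).symm ((splitEquiv d w.2).1, (splitEquiv d w.1).2)))

/-- `wignerModulation` is the inverse transpose of `A` applied to `(ζ₁, z₂)`. The adjoint is taken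
on the Euclidean `ℝ^{2d}` because the product space carries the max norm. -/
theorem inner_wignerModulation (A : GL (Fin d ⊕ Fin d) ℝ)
    (w : EuclideanSpace ℝ (Fin d ⊕ Fin d) × EuclideanSpace ℝ (Fin d ⊕ Fin d))
    (p : EuclideanSpace ℝ (Fin d) × EuclideanSpace ℝ (Fin d)) :
    ⟪(blockEquiv A p).1, (wignerModulation A w).1⟫ +
        ⟪(blockEquiv A p).2, (wignerModulation A w).2⟫ =
      ⟪p.1, (splitEquiv d w.2).1⟫ + ⟪p.2, (splitEquiv d w.1).2⟫ := by
  have h := inner_eq_inner_splitEquiv ((splitEquiv d).symm (blockEquiv A p))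
    ((splitEquiv d).symm (wignerModulation A w))
  rw [ContinuousLinearEquiv.apply_symm_apply, ContinuousLinearEquiv.apply_symm_apply] at h
  rw [← h, wignerModulation, ContinuousLinearEquiv.symm_apply_apply,
    ContinuousLinearMap.adjoint_inner_right, inner_eq_inner_splitEquiv]
  simp

theorem continuous_wignerTranslation (A : GL (Fin d ⊕ Fin d) ℝ) :
    Continuous (wignerTranslation A) := by
  unfold wignerTranslation
  fun_prop

theorem continuous_wignerModulation (A : GL (Fin d ⊕ Fin d) ℝ) :
    Continuous (wignerModulation A) := by
  unfold wignerModulation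
  fun_prop

/-- The covariance of `B_A` under time-frequency shifts. -/
theorem timeFreqShift_matrixWigner (A : GL (Fin d ⊕ Fin d) ℝ)
    (f g : 𝓢(EuclideanSpace ℝ (Fin d), ℂ))
    (w : EuclideanSpace ℝ (Fin d ⊕ Fin d) × EuclideanSpace ℝ (Fin d ⊕ Fin d)) :
    timeFreqShift w.1 w.2 (matrixWigner A f g) =
      Complex.exp (2 * Real.pi * Complex.I * ⟪(splitEquiv d w.2).2, (splitEquiv d w.1).2⟫) •
        matrixWigner A (timeFreqShift (wignerTranslation A w).1 (wignerModulation A w).1 f)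
          (timeFreqShift (wignerTranslation A w).2 (-(wignerModulation A w).2) g) := by
  ext t
  rw [timeFreqShift_apply, inner_eq_inner_splitEquiv]
  set x := (splitEquiv d t).1
  set ω := (splitEquiv d t).2
  set ζ₁ := (splitEquiv d w.2).1
  set ζ₂ := (splitEquiv d w.2).2
  set z₁ := (splitEquiv d w.1).1
  set z₂ := (splitEquiv d w.1).2
  set η₁ := (wignerModulation A w).1
  set η₂ := (wignerModulation A w).2
  have hL : matrixWigner A f g (t - w.1) = ∫ y : EuclideanSpace ℝ (Fin d),
      Real.fourierChar (-⟪y, ω - z₂⟫) • (f (blockEquiv A (x - z₁, y)).1 *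
        schwartzConj g (blockEquiv A (x - z₁, y)).2) := by
    change ∫ y : EuclideanSpace ℝ (Fin d), Real.fourierChar (-⟪y, (splitEquiv d (t - w.1)).2⟫) •
      (f (blockEquiv A ((splitEquiv d (t - w.1)).1, y)).1 *
        schwartzConj g (blockEquiv A ((splitEquiv d (t - w.1)).1, y)).2) = _
    rw [map_sub]
    rfl
  change _ = Complex.exp _ * ∫ y : EuclideanSpace ℝ (Fin d), Real.fourierChar (-⟪y, ω⟫) •
      (timeFreqShift (wignerTranslation A w).1 η₁ f (blockEquiv A (x, y)).1 *
        schwartzConj (timeFreqShift (wignerTranslation A w).2 (-η₂) g) (blockEquiv A (x, y)).2)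
  -- Substituting `y + ζ₂` for `y` on the left aligns the arguments of `f` and `g`. Of the exponents
  -- only `ζ₂ · z₂` is not absorbed by the shifts, which is the phase in the statement.
  rw [hL, ← integral_const_mul, ← integral_const_mul, ← integral_add_right_eq_self _ ζ₂]
  refine integral_congr_ae (Filter.Eventually.of_forall fun y => ?_)
  beta_reduce
  have hb : blockEquiv A (x, y) - wignerTranslation A w = blockEquiv A (x - z₁, y + ζ₂) := by
    rw [wignerTranslation, ← map_sub, Prod.mk_sub_mk, sub_neg_eq_add]
  have hη := inner_wignerModulation A w (x, y)
  change ⟪_, η₁⟫ + ⟪_, η₂⟫ = ⟪x, ζ₁⟫ + ⟪y, z₂⟫ at hη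
  rw [schwartzConj_timeFreqShift, neg_neg, timeFreqShift_apply, timeFreqShift_apply,
    show (blockEquiv A (x, y)).1 - (wignerTranslation A w).1 = _ from congrArg Prod.fst hb,
    show (blockEquiv A (x, y)).2 - (wignerTranslation A w).2 = _ from congrArg Prod.snd hb]
  simp only [Circle.smul_def, smul_eq_mul, Real.fourierChar_apply]
  set P := f (blockEquiv A (x - z₁, y + ζ₂)).1
  set Q := schwartzConj g (blockEquiv A (x - z₁, y + ζ₂)).2
  have e : ∀ a b c l m : ℂ, a + b = c + l + m →
      Complex.exp a * (Complex.exp b * (P * Q)) =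
        Complex.exp c * (Complex.exp l * (Complex.exp m * (P * Q))) := by
    intro a b c l m h
    rw [← mul_assoc, ← mul_assoc (Complex.exp l), ← mul_assoc (Complex.exp c), ← Complex.exp_add,
      ← Complex.exp_add, ← Complex.exp_add, h, add_assoc]
  have e2 : ∀ a b : ℂ, Complex.exp a * P * (Complex.exp b * Q) = Complex.exp (a + b) * (P * Q) := by
    intro a b
    rw [Complex.exp_add]
    ring
  rw [e2, ← mul_add, ← Complex.ofReal_add, hη]
  refine e _ _ _ _ _ ?_
  simp only [inner_sub_right, inner_add_left, real_inner_comm ζ₂ ω]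
  push_cast
  ring

theorem IsMatrixQuantization.unique {A : GL (Fin d ⊕ Fin d) ℝ}
    {σ : 𝓢'(EuclideanSpace ℝ (Fin d ⊕ Fin d), ℂ)}
    {T S : Lp ℂ 2 (volume : Measure (EuclideanSpace ℝ (Fin d))) →L[ℂ]
      Lp ℂ 2 (volume : Measure (EuclideanSpace ℝ (Fin d)))}
    (hT : IsMatrixQuantization A σ T) (hS : IsMatrixQuantization A σ S) : T = S := by
  have hd : DenseRange (fun f : 𝓢(EuclideanSpace ℝ (Fin d), ℂ) => f.toLp 2 volume) :=
    denseRange_toLpCLM ENNReal.ofNat_ne_top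
  refine ContinuousLinearMap.ext fun x => ?_
  refine congrFun (hd.equalizer T.continuous S.continuous (funext fun f => ?_)) x
  refine ext_inner_left ℂ fun y => ?_
  exact hd.induction_on (p := fun y => inner ℂ y (T (f.toLp 2 volume)) =
    inner ℂ y (S (f.toLp 2 volume))) y (isClosed_eq (by fun_prop) (by fun_prop))
    fun g => (hT f g).trans (hS f g).symm

/-- The quantization of a symbol in `M¹` is an integral of operators of rank one. -/
theorem exists_matrixQuantization_traceNorm_le (A : GL (Fin d ⊕ Fin d) ℝ)
    {Φ : 𝓢(EuclideanSpace ℝ (Fin d ⊕ Fin d), ℂ)} (hΦ : Φ ≠ 0) :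
    ∃ C : ℝ, 0 < C ∧ ∀ σ : 𝓢'(EuclideanSpace ℝ (Fin d ⊕ Fin d), ℂ), MemModulationOne Φ σ →
      ∃ T, IsMatrixQuantization A σ T ∧
        traceNorm T ≤ ENNReal.ofReal C * modulationNorm Φ σ := by
  obtain ⟨κ, hκ, hmoyal⟩ := exists_integral_matrixWigner_mul_conj A
  obtain ⟨f₀, g₀, hne⟩ := exists_integral_mul_conj_matrixWigner_ne_zero A hΦ
  set c := ∫ t, Φ t * conj (matrixWigner A f₀ g₀ t)
  set M := ‖f₀.toLp 2 volume‖
  set N := ‖g₀.toLp 2 volume‖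
  -- `conj c` comes from the inversion formula and `κ` from Moyal's identity.
  set k : ℂ := (conj c)⁻¹ * κ
  let u : EuclideanSpace ℝ (Fin d ⊕ Fin d) × EuclideanSpace ℝ (Fin d ⊕ Fin d) →
      Lp ℂ 2 (volume : Measure (EuclideanSpace ℝ (Fin d))) := fun w =>
    (timeFreqShift (wignerTranslation A w).1 (wignerModulation A w).1 f₀).toLp 2 volume
  let v : EuclideanSpace ℝ (Fin d ⊕ Fin d) × EuclideanSpace ℝ (Fin d ⊕ Fin d) →
      Lp ℂ 2 (volume : Measure (EuclideanSpace ℝ (Fin d))) := fun w =>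
    (timeFreqShift (wignerTranslation A w).2 (-(wignerModulation A w).2) g₀).toLp 2 volume
  let φ : EuclideanSpace ℝ (Fin d ⊕ Fin d) × EuclideanSpace ℝ (Fin d ⊕ Fin d) →
      ℂ := fun w =>
    Complex.exp (2 * Real.pi * Complex.I * ⟪(splitEquiv d w.2).2, (splitEquiv d w.1).2⟫)
  have hLp : Continuous fun f : 𝓢(EuclideanSpace ℝ (Fin d), ℂ) => f.toLp 2 volume :=
    continuous_toLp
  have hu : StronglyMeasurable u :=
    (stronglyMeasurable_comp_timeFreqShift hLp f₀).comp_measurable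
      (g := fun w => ((wignerTranslation A w).1, (wignerModulation A w).1))
      ((continuous_wignerTranslation A).fst.prodMk
        (continuous_wignerModulation A).fst).measurable
  have hv : StronglyMeasurable v :=
    (stronglyMeasurable_comp_timeFreqShift hLp g₀).comp_measurable
      (g := fun w => ((wignerTranslation A w).2, -(wignerModulation A w).2))
      ((continuous_wignerTranslation A).snd.prodMk
        (continuous_wignerModulation A).snd.neg).measurable
  have hφ : Continuous φ := by
    have : Continuous fun w : EuclideanSpace ℝ (Fin d ⊕ Fin d) × EuclideanSpace ℝ (Fin d ⊕ Fin d) =>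
        ⟪(splitEquiv d w.2).2, (splitEquiv d w.1).2⟫ := by
      fun_prop
    exact Complex.continuous_exp.comp
      (continuous_const.mul (Complex.continuous_ofReal.comp this))
  have hφ1 : ∀ w, ‖φ w‖ = 1 := by
    intro w
    have h1 : (2 * Real.pi * Complex.I * ⟪(splitEquiv d w.2).2, (splitEquiv d w.1).2⟫ : ℂ) =
        ((2 * Real.pi * ⟪(splitEquiv d w.2).2, (splitEquiv d w.1).2⟫ : ℝ) : ℂ) * Complex.I := by
      push_cast
      ring
    change ‖Complex.exp _‖ = 1
    rw [h1, Complex.norm_exp_ofReal_mul_I]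
  have hM : ∀ w, ‖u w‖ ≤ M := fun w => (norm_toLp_timeFreqShift _ _ _).le
  have hN : ∀ w, ‖v w‖ ≤ N := fun w => (norm_toLp_timeFreqShift _ _ _).le
  -- The `+ 1` only makes the constant visibly positive.
  refine ⟨‖k‖ * (M * N) + 1, by positivity, fun σ hσ => ?_⟩
  let a : EuclideanSpace ℝ (Fin d ⊕ Fin d) × EuclideanSpace ℝ (Fin d ⊕ Fin d) →
      ℂ := fun w => k * φ w * stft Φ σ w.1 w.2
  have hs : Integrable fun w : EuclideanSpace ℝ (Fin d ⊕ Fin d) ×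
      EuclideanSpace ℝ (Fin d ⊕ Fin d) => stft Φ σ w.1 w.2 :=
    ⟨(stronglyMeasurable_stft Φ σ).aestronglyMeasurable, hσ⟩
  have ha : Integrable a := by
    refine hs.bdd_mul (c := ‖k‖) (continuous_const.mul hφ).aestronglyMeasurable
      (Filter.Eventually.of_forall fun w => ?_)
    rw [norm_mul, hφ1, mul_one]
  refine ⟨∫ w, a w • InnerProductSpace.rankOne ℂ (u w) (v w), fun f g => ?_, ?_⟩
  · refine (inner_integral_smul_rankOne_apply ha hu.aestronglyMeasurable hv.aestronglyMeasurable
      hM hN (g.toLp 2 volume) (f.toLp 2 volume)).2.trans ?_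
    -- Inversion with analysis window `Φ` and dual window `B_A(f₀, g₀)`; covariance and Moyal then
    -- split the integrand into the matrix elements of `u w ⊗ (v w)*`.
    have h := integral_stft_mul σ (matrixWigner A f₀ g₀) (matrixWigner A g f) Φ
    have hc : conj c ≠ 0 := (map_ne_zero _).2 hne
    rw [← inv_mul_eq_iff_eq_mul₀ hc, ← integral_const_mul] at h
    refine Eq.trans (integral_congr_ae (Filter.Eventually.of_forall fun w => ?_)) h
    have e : ∀ t, timeFreqShift w.1 w.2 (matrixWigner A f₀ g₀) t * conj (matrixWigner A g f t) =
        φ w * (matrixWigner A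
          (timeFreqShift (wignerTranslation A w).1 (wignerModulation A w).1 f₀)
          (timeFreqShift (wignerTranslation A w).2 (-(wignerModulation A w).2) g₀) t *
            conj (matrixWigner A g f t)) := by
      intro t
      rw [timeFreqShift_matrixWigner, ← mul_assoc]
      rfl
    simp only [conj_schwartzSTFT, e, integral_const_mul, hmoyal]
    change inner ℂ _ (u w) * (inner ℂ (v w) _ * (k * φ w * stft Φ σ w.1 w.2)) =
      (conj c)⁻¹ * (stft Φ σ w.1 w.2 * (φ w * (κ * (inner ℂ _ (u w) * inner ℂ (v w) _))))
    ring
  · refine (traceNorm_integral_smul_rankOne_le ha hu.aestronglyMeasurable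
      hv.aestronglyMeasurable hM hN (norm_nonneg _)).trans ?_
    have e : ∀ w, ‖a w‖ₑ = ‖k‖ₑ * ‖stft Φ σ w.1 w.2‖ₑ := by
      intro w
      change ‖k * φ w * stft Φ σ w.1 w.2‖ₑ = _
      rw [enorm_mul, enorm_mul, ← ofReal_norm (φ w), hφ1, ENNReal.ofReal_one, mul_one]
    simp_rw [e]
    rw [lintegral_const_mul _ (stronglyMeasurable_stft Φ σ).enorm, ← mul_assoc,
      ← ofReal_norm, ← ENNReal.ofReal_mul (by positivity)]
    change _ * modulationNorm Φ σ ≤ _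
    gcongr
    nlinarith

end Quantization

theorem mainTheorem6 (d : ℕ) (A : GL (Fin d ⊕ Fin d) ℝ)
    (Φ : 𝓢(EuclideanSpace ℝ (Fin d ⊕ Fin d), ℂ)) (hΦ : Φ ≠ 0) :
    ∃ C : ℝ, 0 < C ∧
      ∀ σ : 𝓢'(EuclideanSpace ℝ (Fin d ⊕ Fin d), ℂ), MemModulationOne Φ σ →
        (∃! T : Lp ℂ 2 (volume : Measure (EuclideanSpace ℝ (Fin d))) →L[ℂ]
            Lp ℂ 2 (volume : Measure (EuclideanSpace ℝ (Fin d))), IsMatrixQuantization A σ T) ∧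
        ∀ T : Lp ℂ 2 (volume : Measure (EuclideanSpace ℝ (Fin d))) →L[ℂ]
            Lp ℂ 2 (volume : Measure (EuclideanSpace ℝ (Fin d))), IsMatrixQuantization A σ T →
          IsTraceClass T ∧
            traceNorm T ≤ ENNReal.ofReal
              (C * |(A : Matrix (Fin d ⊕ Fin d) (Fin d ⊕ Fin d) ℝ).det| ^ (1 / 2 : ℝ)) *
                modulationNorm Φ σ := by 
  obtain ⟨K, hK, h⟩ := exists_matrixQuantization_traceNorm_le A hΦ
  have hdet : 0 < |(A : Matrix (Fin d ⊕ Fin d) (Fin d ⊕ Fin d) ℝ).det| ^ (1 / 2 : ℝ) :=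
    Real.rpow_pos_of_pos (abs_pos.2 A.det.ne_zero) _
  -- `K` already depends on `A`, so the determinant factor is absorbed into the constant.
  refine ⟨K / |(A : Matrix (Fin d ⊕ Fin d) (Fin d ⊕ Fin d) ℝ).det| ^ (1 / 2 : ℝ), by positivity,
    fun σ hσ => ?_⟩
  obtain ⟨T, hT, hle⟩ := h σ hσ
  rw [div_mul_cancel₀ _ hdet.ne']
  refine ⟨⟨T, hT, fun S hS => IsMatrixQuantization.unique hS hT⟩, fun S hS => ?_⟩
  rw [IsMatrixQuantization.unique hS hT]
  exact ⟨hle.trans_lt (ENNReal.mul_lt_top ENNReal.ofReal_lt_top hσ), hle⟩
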